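/- Let $\omega=(0,1)^2$, let $L_1,L_2>0$, and let $G:\mathbb R^2\to\mathbb R$ be smooth, $L_1$-periodic in the first and $L_2$-periodic in the second variable, with $0<G_0\le G\le G_1$ for constants $G_0,G_1$. Write $x=(\hat x,x_3)\in\mathbb R^2\times\mathbb R$, and for $\varepsilon>0$ set $$\Omega_\varepsilon=\{(\hat x,x_3):\hat x\in\omega,\ 0<x_3<\varepsilon G(\hat x/\varepsilon)\},\quad \tilde\Omega_\varepsilon=\{(\hat x,y_3):\hat x\in\omega,\ 0<y_3<G(\hat x/\varepsilon)\},\quad \Omega=\omega\times(0,G_1),$$ and $V_\varepsilon=\{v\in H^1_0(\Omega_\varepsilon)^3:\operatorname{div}v=0\}$. Fix $\mu,g>0$. Let $\mathbf f_\varepsilon\in L^2(\Omega_\varepsilon)^3$ satisfy $\varepsilon^{-1/2}\|\mathbf f_\varepsilon\|_{L^2(\Omega_\varepsilon)^3}\le C$ with $C$ independent of $\varepsilon$, and let $\mathbf u_\varepsilon\in V_\varepsilon$ be the Bingham velocity, i.e. the solution of $$\mu\varepsilon^2\int_{\Omega_\varepsilon}\nabla \mathbf u_\varepsilon\cdot\nabla(\mathbf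 v-\mathbf u_\varepsilon)\,dx+g\varepsilon\int_{\Omega_\varepsilon}|\nabla \mathbf v|\,dx-g\varepsilon\int_{\Omega_\varepsilon}|\nabla \mathbf u_\varepsilon|\,dx\ \ge\ \int_{\Omega_\varepsilon}\mathbf f_\varepsilon\cdot(\mathbf v-\mathbf u_\varepsilon)\,dx\qquad\forall\,\mathbf v\in V_\varepsilon,$$ where $|\cdot|$ is the Euclidean (Frobenius) norm. Let $\tilde{\mathbf U}_\varepsilon$ be the extension by zero to $\Omega$ of $\mathbf U_\varepsilon(\hat x,y_3)=\mathbf u_\varepsilon(\hat x,\varepsilon y_3)$, $(\hat x,y_3)\in\tilde\Omega_\varepsilon$. Then $\tilde{\mathbf U}_\varepsilon\in H^1_0(\Omega)^3$ and $\tilde{\mathbf U}_\varepsilon\in H^1((0,G_1);L^2(\omega)^3)$. From every sequence of positive $\varepsilon$ tending to $0$ one can extract a subsequence along which, for some $\mathbf U\in H^1((0,G_1);L^2(\omega)^3)$, $$\tilde{\mathbf U}_\varepsilon\rightharpoonup \mathbf U\quad\text{weakly in }H^1((0,G_1);L^2(\omega)^3).$$ Moreover $\mathbf U=(\hat U,0)$,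 that is $U_3=0$ almost everywhere, and the field $\int_0^{G_1}\hat U(\cdot,y_3)\,dy_3\in L^2(\omega)^2$ satisfies $$\operatorname{div}_{\hat x}\Big(\int_0^{G_1}\hat U(\hat x,y_3)\,dy_3\Big)=0\ \text{ in }\omega,\qquad \Big(\int_0^{G_1}\hat U(\hat x,y_3)\,dy_3\Big)\cdot n=0\ \text{ on }\partial\omega,$$ the divergence being taken in the sense of distributions, $n$ being the outward normal to $\omega$, and the normal trace of a field $V\in L^2(\omega)^2$ with $\operatorname{div}V\in L^2(\omega)$ being defined by Green's formula $\langle V\cdot n,\psi\rangle=\int_\omega V\cdot\nabla\psi+\int_\omega(\operatorname{div}V)\,\psi$ for $\psi\in H^1(\omega)$. -/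

import Mathlib

open MeasureTheory Filter Topology
open scoped ContDiff InnerProductSpace

namespace BinghamThin

noncomputable section

/-! ### Sobolev spaces on an open subset of Euclidean space -/

/-- Gradients of `F`-valued functions of `d` variables: `(∇u) j = ∂ⱼ u`. The norm and the inner
product are the Euclidean (Frobenius) ones, `∇u · ∇v = ∑ⱼ ∂ⱼu · ∂ⱼv` and `|∇u|² = ∑ⱼ |∂ⱼu|²`. -/
abbrev Grad (d : ℕ) (F : Type*) := PiLp 2 (fun _ : Fin d => F)

/-- The classical gradient of a differentiable function. -/
def classicalGrad {d : ℕ} {F : Type*} [NormedAddCommGroup F] [NormedSpace ℝ F]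
    (φ : EuclideanSpace ℝ (Fin d) → F) (x : EuclideanSpace ℝ (Fin d)) : Grad d F :=
  WithLp.toLp 2 (fun j => fderiv ℝ φ x (EuclideanSpace.single j 1))

/-- Test functions: smooth functions with compact support contained in `Ω`. -/
def IsTest {E F : Type*} [NormedAddCommGroup E] [NormedSpace ℝ E]
    [NormedAddCommGroup F] [NormedSpace ℝ F] (Ω : Set E) (φ : E → F) : Prop :=
  ContDiff ℝ ∞ φ ∧ HasCompactSupport φ ∧ tsupport φ ⊆ Ω

/-- `u ∈ H¹(Ω)` and `Du` is its weak gradient. Only the values in `Ω` matter. -/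
def HasH1Grad {d : ℕ} {F : Type*} [NormedAddCommGroup F] [NormedSpace ℝ F] [CompleteSpace F]
    (Ω : Set (EuclideanSpace ℝ (Fin d))) (u : EuclideanSpace ℝ (Fin d) → F)
    (Du : EuclideanSpace ℝ (Fin d) → Grad d F) : Prop :=
  MemLp u 2 (volume.restrict Ω) ∧ MemLp Du 2 (volume.restrict Ω) ∧
    ∀ φ : EuclideanSpace ℝ (Fin d) → ℝ, IsTest Ω φ → ∀ j : Fin d,
      ∫ x in Ω, classicalGrad φ x j • u x = -∫ x in Ω, φ x • Du x j

/-- `u ∈ H¹₀(Ω)` with weak gradient `Du`: `u ∈ H¹(Ω)` is a limit, for the `H¹` norm, of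
test functions on `Ω`. -/
def HasH10Grad {d : ℕ} {F : Type*} [NormedAddCommGroup F] [NormedSpace ℝ F] [CompleteSpace F]
    (Ω : Set (EuclideanSpace ℝ (Fin d))) (u : EuclideanSpace ℝ (Fin d) → F)
    (Du : EuclideanSpace ℝ (Fin d) → Grad d F) : Prop :=
  HasH1Grad Ω u Du ∧ ∃ φ : ℕ → EuclideanSpace ℝ (Fin d) → F, (∀ k, IsTest Ω (φ k)) ∧
    Tendsto (fun k => eLpNorm (φ k - u) 2 (volume.restrict Ω)) atTop (𝓝 0) ∧
    Tendsto (fun k => eLpNorm (classicalGrad (φ k) - Du) 2 (volume.restrict Ω)) atTop (𝓝 0)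

/-- Membership in `H¹₀(Ω)`. -/
def MemH10 {d : ℕ} {F : Type*} [NormedAddCommGroup F] [NormedSpace ℝ F] [CompleteSpace F]
    (Ω : Set (EuclideanSpace ℝ (Fin d))) (u : EuclideanSpace ℝ (Fin d) → F) : Prop :=
  ∃ Du, HasH10Grad Ω u Du

/-- The field `V ∈ L²(Ω)ᵈ` has the distributional divergence `δ ∈ L²(Ω)` in `Ω`. -/
def HasWeakDiv {d : ℕ} (Ω : Set (EuclideanSpace ℝ (Fin d)))
    (V : EuclideanSpace ℝ (Fin d) → EuclideanSpace ℝ (Fin d))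
    (δ : EuclideanSpace ℝ (Fin d) → ℝ) : Prop :=
  MemLp V 2 (volume.restrict Ω) ∧ MemLp δ 2 (volume.restrict Ω) ∧
    ∀ φ : EuclideanSpace ℝ (Fin d) → ℝ, IsTest Ω φ →
      ∫ x in Ω, ⟪V x, classicalGrad φ x⟫_ℝ = -∫ x in Ω, δ x * φ x

/-- `V · n = 0` on `∂Ω`, for a field `V ∈ L²(Ω)ᵈ` with `div V ∈ L²(Ω)`. The normal trace of such
a field is the functional on traces of `H¹(Ω)` functions given by Green's formula,
`⟨V · n, ψ⟩ = ∫_Ω V · ∇ψ + ∫_Ω (div V) ψ` for `ψ ∈ H¹(Ω)`; it is required to vanish. -/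
def ZeroNormalTrace {d : ℕ} (Ω : Set (EuclideanSpace ℝ (Fin d)))
    (V : EuclideanSpace ℝ (Fin d) → EuclideanSpace ℝ (Fin d)) : Prop :=
  ∃ δ : EuclideanSpace ℝ (Fin d) → ℝ, HasWeakDiv Ω V δ ∧
    ∀ (ψ : EuclideanSpace ℝ (Fin d) → ℝ) (Dψ : EuclideanSpace ℝ (Fin d) → Grad d ℝ),
      HasH1Grad Ω ψ Dψ → (∫ x in Ω, ⟪V x, Dψ x⟫_ℝ) + ∫ x in Ω, δ x * ψ x = 0

/-! ### The space `H¹((a, b); X)` of vector-valued functions -/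

theorem integrable_smul_Lp {X : Type*} [NormedAddCommGroup X] [NormedSpace ℝ X] {a b : ℝ}
    {φ : ℝ → ℝ} (hφ : Continuous φ) (hc : HasCompactSupport φ)
    (u : Lp X 2 (volume.restrict (Set.Ioo a b))) :
    Integrable (fun t => φ t • u t) (volume.restrict (Set.Ioo a b)) := by
  have hu : Integrable u (volume.restrict (Set.Ioo a b)) :=
    (Lp.memLp u).integrable one_le_two
  obtain ⟨C, hC⟩ := hc.exists_bound_of_continuous hφ
  exact hu.bdd_smul C hφ.aestronglyMeasurable (ae_of_all _ hC)

/-- The Hilbert space `H¹((a, b); X)`: pairs `(u, u')` in `L²((a, b); X)²` such that `u'` is the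
weak derivative of `u`, with the norm `(‖u‖² + ‖u'‖²)^(1/2)`. -/
def H1 (a b : ℝ) (X : Type*) [NormedAddCommGroup X] [NormedSpace ℝ X]
    [CompleteSpace X] :
    Submodule ℝ (WithLp 2 (Lp X 2 (volume.restrict (Set.Ioo a b)) ×
      Lp X 2 (volume.restrict (Set.Ioo a b)))) where
  carrier := {p | ∀ φ : ℝ → ℝ, IsTest (Set.Ioo a b) φ →
    ∫ t in Set.Ioo a b, deriv φ t • p.fst t = -∫ t in Set.Ioo a b, φ t • p.snd t}
  zero_mem' := by
    intro φ _
    have h : ∀ (ψ : ℝ → ℝ), ∫ t in Set.Ioo a b,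
        ψ t • (0 : Lp X 2 (volume.restrict (Set.Ioo a b))) t = 0 := by
      intro ψ
      rw [integral_eq_zero_of_ae]
      filter_upwards [Lp.coeFn_zero X 2 (volume.restrict (Set.Ioo a b))] with t ht
      rw [ht, Pi.zero_apply, smul_zero]
    have h1 := h (deriv φ)
    have h2 := h φ
    simp only [WithLp.zero_fst, WithLp.zero_snd, h1, h2, neg_zero]
  add_mem' := by
    intro p q hp hq φ hφ
    have hd : Continuous (deriv φ) := hφ.1.continuous_deriv (by simp)
    have key : ∀ (ψ : ℝ → ℝ), Continuous ψ → HasCompactSupport ψ →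
        ∀ u v : Lp X 2 (volume.restrict (Set.Ioo a b)),
        ∫ t in Set.Ioo a b, ψ t • (u + v) t =
          (∫ t in Set.Ioo a b, ψ t • u t) + ∫ t in Set.Ioo a b, ψ t • v t := by
      intro ψ hψ hc u v
      rw [← integral_add (integrable_smul_Lp hψ hc u) (integrable_smul_Lp hψ hc v)]
      refine integral_congr_ae ?_
      filter_upwards [Lp.coeFn_add u v] with t ht
      rw [ht, Pi.add_apply, smul_add]
    simp only [WithLp.add_fst, WithLp.add_snd]
    rw [key _ hd hφ.2.1.deriv, key _ hφ.1.continuous hφ.2.1, hp φ hφ, hq φ hφ]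
    abel
  smul_mem' := by
    intro c p hp φ hφ
    have key : ∀ (ψ : ℝ → ℝ) (u : Lp X 2 (volume.restrict (Set.Ioo a b))),
        ∫ t in Set.Ioo a b, ψ t • (c • u) t = c • ∫ t in Set.Ioo a b, ψ t • u t := by
      intro ψ u
      rw [← integral_smul]
      refine integral_congr_ae ?_
      filter_upwards [Lp.coeFn_smul c u] with t ht
      rw [ht, Pi.smul_apply, smul_comm]
    simp only [WithLp.smul_fst, WithLp.smul_snd]
    rw [key, key, hp φ hφ, smul_neg]

/-- The function `t ↦ u(t)` underlying an element of `H¹((a, b); X)`. -/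
def h1Fun {a b : ℝ} {X : Type*} [NormedAddCommGroup X] [NormedSpace ℝ X]
    [CompleteSpace X] (u : H1 a b X) : ℝ → X :=
  (u : WithLp 2 (Lp X 2 (volume.restrict (Set.Ioo a b)) ×
    Lp X 2 (volume.restrict (Set.Ioo a b)))).fst

/-- Weak convergence in a normed space. -/
def WeakTendsto {E : Type*} [NormedAddCommGroup E] [NormedSpace ℝ E] (x : ℕ → E) (a : E) : Prop :=
  Tendsto (fun n => toWeakSpace ℝ E (x n)) atTop (𝓝 (toWeakSpace ℝ E a))

/-! ### The thin domain and the Bingham problem -/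

/-- The plane and the space with their Euclidean norms. -/
abbrev E2 := EuclideanSpace ℝ (Fin 2)

/-- See `E2`. -/
abbrev E3 := EuclideanSpace ℝ (Fin 3)

/-- The horizontal part `x̂ = (x₁, x₂)` of `x = (x̂, x₃)`. -/
def hat : E3 →L[ℝ] E2 :=
  LinearMap.toContinuousLinearMap
    { toFun := fun x => !₂[x 0, x 1]
      map_add' := fun x y => by ext i; fin_cases i <;> simp
      map_smul' := fun c x => by ext i; fin_cases i <;> simp }

/-- The point `(x̂, t)`. -/
def join (x : E2) (t : ℝ) : E3 := !₂[x 0, x 1, t]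

/-- `ω = (0, 1)²`. -/
def omega : Set E2 := {x | ∀ i, 0 < x i ∧ x i < 1}

/-- `Ω_ε`, given by `x̂ ∈ ω` and `0 < x₃ < ε G(x̂ / ε)`. -/
def thinDomain (G : E2 → ℝ) (ε : ℝ) : Set E3 :=
  {x | hat x ∈ omega ∧ 0 < x 2 ∧ x 2 < ε * G (ε⁻¹ • hat x)}

/-- The vertically stretched domain, given by `x̂ ∈ ω` and `0 < y₃ < G(x̂ / ε)`. -/
def stretchedDomain (G : E2 → ℝ) (ε : ℝ) : Set E3 :=
  {x | hat x ∈ omega ∧ 0 < x 2 ∧ x 2 < G (ε⁻¹ • hat x)}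

/-- `Ω = ω × (0, G₁)`. -/
def fixedDomain (G₁ : ℝ) : Set E3 := {x | hat x ∈ omega ∧ 0 < x 2 ∧ x 2 < G₁}

/-- `v ∈ V`, the divergence-free fields of `H¹₀(Ω)³`, and `Dv` is the gradient of `v`. -/
def IsAdmissible (Ω : Set E3) (v : E3 → E3) (Dv : E3 → Grad 3 E3) : Prop :=
  HasH10Grad Ω v Dv ∧ ∀ᵐ x ∂(volume.restrict Ω), ∑ j : Fin 3, Dv x j j = 0

/-- `u` is the velocity of the Bingham flow in `Ω_ε` with viscosity `μ ε²`, yield stress `g ε` and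
body force `f`, that is, it solves the variational inequality in the space of admissible fields. -/
def IsBinghamVelocity (μ g : ℝ) (G : E2 → ℝ) (ε : ℝ) (f u : E3 → E3) : Prop :=
  ∃ Du : E3 → Grad 3 E3, IsAdmissible (thinDomain G ε) u Du ∧
    ∀ (v : E3 → E3) (Dv : E3 → Grad 3 E3), IsAdmissible (thinDomain G ε) v Dv →
      μ * ε ^ 2 * (∫ x in thinDomain G ε, ⟪Du x, Dv x - Du x⟫_ℝ)
          + g * ε * (∫ x in thinDomain G ε, ‖Dv x‖) - g * ε * (∫ x in thinDomain G ε, ‖Du x‖)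
        ≥ ∫ x in thinDomain G ε, ⟪f x, v x - u x⟫_ℝ

/-- The rescaled norm `ε^(-1/2) ‖φ‖` of `L²(Ω_ε)`. -/
def rescaledL2Norm (G : E2 → ℝ) (ε : ℝ) (φ : E3 → E3) : ℝ :=
  ε ^ (-(1 / 2) : ℝ) * (eLpNorm φ 2 (volume.restrict (thinDomain G ε))).toReal

/-- The extension by zero of the rescaled velocity `(x̂, y₃) ↦ u(x̂, ε y₃)`. -/
def rescaledVelocity (G : E2 → ℝ) (ε : ℝ) (u : E3 → E3) : E3 → E3 :=
  (stretchedDomain G ε).indicator (fun x => u (join (hat x) (ε * x 2)))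

/-- `L²(ω)³`. -/
abbrev L2omega3 := Lp E3 2 (volume.restrict omega)

/-- The element `W` of `H¹((0, G₁); L²(ω)³)` is the function `w` of `(x̂, y₃)`. -/
def Represents {G₁ : ℝ} (W : H1 0 G₁ L2omega3) (w : E3 → E3) : Prop :=
  ∀ᵐ t ∂(volume.restrict (Set.Ioo 0 G₁)), ∀ᵐ x ∂(volume.restrict omega),
    h1Fun W t x = w (join x t)

/-- `∫₀^{G₁} Û(·, y₃) dy₃ ∈ L²(ω)²`, where `Û` is the horizontal part of `U`. -/
def verticalIntegral {G₁ : ℝ} (U : H1 0 G₁ L2omega3) : Lp E2 2 (volume.restrict omega) :=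
  ∫ t in Set.Ioo 0 G₁, hat.compLp (h1Fun U t)

end

end BinghamThin

namespace BinghamThin

noncomputable section

/-! ### Pairing of square integrable functions with scalar weights -/

/-! Compactness comes from an energy estimate. Testing the variational inequality with the zero
field and dropping the nonnegative yield term gives `μ ε² ‖∇u‖² ≤ ‖f‖ ‖u‖`
(`IsBinghamVelocity.energy`). The domain has height at most `ε G₁`, so the Poincaré inequality in
the vertical direction gives `‖u‖ ≤ 2 ε G₁ ‖∂₃u‖`, whence `μ ε ‖∇u‖ ≤ 2 G₁ ‖f‖`. After the vertical
dilation both sides carry the same factor `ε^(-1/2)` and `∂₃` picks up a factor `ε`, so `∂₃U_ε` is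
bounded in `L²`; Poincaré in the fixed cylinder then bounds `U_ε` (`IsBinghamVelocity.rescaled`).
This argument bounds horizontal derivatives only by a multiple of `1/ε`, which is why the
compactness is that of the Hilbert space `H¹((0, G₁); L²(ω)³)` alone (`exists_represents`,
`exists_weakTendsto_H1`).

The constraints on the limit come from the rescaled condition `ε (∂₁U₁ + ∂₂U₂) + ∂₃U₃ = 0`. Since
`U_ε ∈ H¹₀`, it can be tested with any `ψ ∈ H¹` of the cylinder without boundary terms
(`integral_grad_eq_zero_of_rescaled_div`). The choice `ψ = Z(y₃) η(x̂)` with `Z' = φ` shows that `∫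
φ η U₃` is of order `ε`, so the limit has no vertical component. The choice `ψ = ψ(x̂)` with `ψ ∈
H¹(ω)` kills the vertical term; after division by `ε`, the vertical integral of the horizontal
velocity is orthogonal to `∇ψ` for every `ε`, hence in the limit. This single orthogonality contains
both the vanishing divergence and the vanishing normal trace.

All quantities passed to the limit are nested weighted integrals, first in `y₃` and then in `x̂`.
Written with `smulIntegral` they are bounded functionals, so weak convergence applies directly, and
Fubini identifies them with integrals over the cylinder. -/

/-- The map `u ↦ ∫ a • u` on `L²`, for a scalar weight `a ∈ L²`. -/
def smulIntegral {α F : Type*} [MeasurableSpace α] [NormedAddCommGroup F] [NormedSpace ℝ F]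
    [CompleteSpace F] {m : Measure α} {a : α → ℝ} (ha : MemLp a 2 m) : Lp F 2 m →L[ℝ] F :=
  (ContinuousLinearMap.lsmul ℝ ℝ).lpPairing m 2 2 (ha.toLp a)

section SmulIntegral

variable {α F : Type*} [MeasurableSpace α] [NormedAddCommGroup F] [NormedSpace ℝ F]
  [CompleteSpace F] {m : Measure α}

theorem smulIntegral_apply {a : α → ℝ} (ha : MemLp a 2 m) (u : Lp F 2 m) :
    smulIntegral ha u = ∫ x, a x • u x ∂m := by
  rw [smulIntegral, ContinuousLinearMap.lpPairing_eq_integral]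
  refine integral_congr_ae ?_
  filter_upwards [ha.coeFn_toLp] with x hx
  simp [hx]

attribute [irreducible] smulIntegral

theorem smulIntegral_toLp {a : α → ℝ} (ha : MemLp a 2 m) {u : α → F} (hu : MemLp u 2 m) :
    smulIntegral ha (hu.toLp u) = ∫ x, a x • u x ∂m := by
  rw [smulIntegral_apply]
  refine integral_congr_ae ?_
  filter_upwards [hu.coeFn_toLp] with x hx
  simp [hx]

omit [CompleteSpace F] in
theorem integrable_smul_of_memLp {a : α → ℝ} (ha : MemLp a 2 m) {u : α → F} (hu : MemLp u 2 m) :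
    Integrable (fun x => a x • u x) m :=
  memLp_one_iff_integrable.1 (hu.smul ha)

/-- Pairing with a fixed `L²` weight is a bounded linear map. This carries integral identities from
approximating test functions to `H¹₀` fields. -/
theorem tendsto_integral_smul {a : α → ℝ} (ha : MemLp a 2 m) {u : ℕ → α → F} {v : α → F}
    (hu : ∀ k, MemLp (u k) 2 m) (hv : MemLp v 2 m)
    (h : Tendsto (fun k => eLpNorm (u k - v) 2 m) atTop (𝓝 0)) :
    Tendsto (fun k => ∫ x, a x • u k x ∂m) atTop (𝓝 (∫ x, a x • v x ∂m)) := by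
  simp_rw [← smulIntegral_toLp ha hv, ← fun k => smulIntegral_toLp ha (hu k)]
  exact ((smulIntegral ha).continuous.tendsto _).comp
    ((Lp.tendsto_Lp_iff_tendsto_eLpNorm'' u hu v hv).2 h)

end SmulIntegral

/-! ### Integration by parts in Sobolev spaces -/

section Sobolev

variable {d : ℕ} {F : Type*} [NormedAddCommGroup F] [NormedSpace ℝ F]

theorem classicalGrad_apply (φ : EuclideanSpace ℝ (Fin d) → F) (x : EuclideanSpace ℝ (Fin d))
    (j : Fin d) : classicalGrad φ x j = fderiv ℝ φ x (EuclideanSpace.single j 1) := rfl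

theorem continuous_classicalGrad {φ : EuclideanSpace ℝ (Fin d) → F} (h : ContDiff ℝ ∞ φ) :
    Continuous (classicalGrad φ) := by
  have := h.continuous_fderiv (by simp)
  exact (PiLp.continuous_toLp 2 _).comp (continuous_pi fun j => this.clm_apply continuous_const)

theorem norm_grad_apply_le {d : ℕ} {F : Type*} [NormedAddCommGroup F] (D : Grad d F) (j : Fin d) :
    ‖D j‖ ≤ ‖D‖ := PiLp.norm_apply_le D j

theorem tsupport_classicalGrad_subset (φ : EuclideanSpace ℝ (Fin d) → F) :
    tsupport (classicalGrad φ) ⊆ tsupport φ := by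
  refine closure_minimal (fun x hx => ?_) (isClosed_tsupport φ)
  by_contra h
  refine hx ?_
  have : fderiv ℝ φ x = 0 := by
    by_contra h'
    exact h (tsupport_fderiv_subset ℝ (subset_tsupport _ h'))
  ext j
  simp [classicalGrad_apply, this]

theorem IsTest.hasCompactSupport_classicalGrad {Ω : Set (EuclideanSpace ℝ (Fin d))}
    {φ : EuclideanSpace ℝ (Fin d) → F} (h : IsTest Ω φ) : HasCompactSupport (classicalGrad φ) :=
  h.2.1.of_isClosed_subset (isClosed_tsupport _) (tsupport_classicalGrad_subset φ)

theorem IsTest.memLp {E : Type*} [NormedAddCommGroup E] [NormedSpace ℝ E] [MeasurableSpace E]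
    [OpensMeasurableSpace E] {Ω : Set E} {φ : E → F} (h : IsTest Ω φ) (m : Measure E)
    [IsFiniteMeasureOnCompacts m] : MemLp φ 2 m :=
  h.1.continuous.memLp_of_hasCompactSupport h.2.1

theorem IsTest.memLp_classicalGrad {Ω : Set (EuclideanSpace ℝ (Fin d))}
    {φ : EuclideanSpace ℝ (Fin d) → F} (h : IsTest Ω φ)
    (m : Measure (EuclideanSpace ℝ (Fin d))) [IsFiniteMeasureOnCompacts m] :
    MemLp (classicalGrad φ) 2 m :=
  (continuous_classicalGrad h.1).memLp_of_hasCompactSupport h.hasCompactSupport_classicalGrad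

theorem memLp_grad_apply {d : ℕ} {F α : Type*} [MeasurableSpace α] {m : Measure α}
    [NormedAddCommGroup F] {D : α → Grad d F} (h : MemLp D 2 m) (j : Fin d) :
    MemLp (fun x => D x j) 2 m :=
  h.mono ((PiLp.continuous_apply 2 _ j).comp_aestronglyMeasurable h.1)
    (ae_of_all _ fun x => norm_grad_apply_le (D x) j)

theorem setIntegral_eq_integral_of_tsupport {E F : Type*} [TopologicalSpace E] [MeasurableSpace E]
    [NormedAddCommGroup F] [NormedSpace ℝ F] {m : Measure E} {Ω : Set E} {φ : E → ℝ}
    (h : tsupport φ ⊆ Ω) (u : E → F) : ∫ x in Ω, φ x • u x ∂m = ∫ x, φ x • u x ∂m :=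
  setIntegral_eq_integral_of_forall_compl_eq_zero fun x hx => by
    rw [image_eq_zero_of_notMem_tsupport fun h' => hx (h h'), zero_smul]

theorem continuous_memLp_of_isBounded {F : Type*} [NormedAddCommGroup F]
    {Ω : Set (EuclideanSpace ℝ (Fin d))} (hΩ : Bornology.IsBounded Ω)
    {φ : EuclideanSpace ℝ (Fin d) → F} (h : Continuous φ) : MemLp φ 2 (volume.restrict Ω) := by
  have hc := hΩ.isCompact_closure
  obtain ⟨C, hC⟩ := hc.exists_bound_of_continuousOn h.continuousOn
  have : IsFiniteMeasure (volume.restrict (closure Ω)) :=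
    isFiniteMeasure_restrict.2 hc.measure_lt_top.ne
  refine MemLp.mono_measure (Measure.restrict_mono_set _ subset_closure) ?_
  exact MemLp.of_bound h.aestronglyMeasurable C
    (ae_restrict_of_forall_mem hc.measurableSet hC)

/-- Smooth functions on the whole space are in `H¹` of bounded sets. -/
theorem hasH1Grad_of_contDiff [CompleteSpace F] {Ω : Set (EuclideanSpace ℝ (Fin d))}
    (hΩ : Bornology.IsBounded Ω) {ψ : EuclideanSpace ℝ (Fin d) → F} (h : ContDiff ℝ ∞ ψ) :
    HasH1Grad Ω ψ (classicalGrad ψ) := by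
  refine ⟨continuous_memLp_of_isBounded hΩ h.continuous,
    continuous_memLp_of_isBounded hΩ (continuous_classicalGrad h), fun φ hφ j => ?_⟩
  have hc : Continuous (fun x => fderiv ℝ φ x (EuclideanSpace.single j 1)) :=
    (hφ.1.continuous_fderiv (by simp)).clm_apply continuous_const
  have hs : HasCompactSupport (fun x => fderiv ℝ φ x (EuclideanSpace.single j 1)) :=
    hφ.2.1.fderiv_apply ℝ _
  have hd : Continuous (fun x => fderiv ℝ ψ x (EuclideanSpace.single j 1)) :=
    (h.continuous_fderiv (by simp)).clm_apply continuous_const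
  -- The compact support of `φ` makes all three products integrable on the whole space, although `ψ`
  -- may grow at infinity.
  have key := integral_smul_fderiv_eq_neg_fderiv_smul_of_integrable (μ := volume)
    (f := φ) (g := ψ) (v := EuclideanSpace.single j 1)
    ((hc.smul h.continuous).integrable_of_hasCompactSupport hs.smul_right)
    ((hφ.1.continuous.smul hd).integrable_of_hasCompactSupport hφ.2.1.smul_right)
    ((hφ.1.continuous.smul h.continuous).integrable_of_hasCompactSupport hφ.2.1.smul_right)
    (fun x _ => (hφ.1.differentiable (by simp)).differentiableAt)
    (fun x _ => (h.differentiable (by simp)).differentiableAt)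
  simp only [classicalGrad_apply]
  rw [setIntegral_eq_integral_of_tsupport hφ.2.2, key, neg_neg]
  refine setIntegral_eq_integral_of_tsupport (φ := fun x => fderiv ℝ φ x _) ?_ _
  exact (tsupport_fderiv_apply_subset ℝ _).trans hφ.2.2

theorem IsTest.hasH1Grad [CompleteSpace F] {Ω Ω' : Set (EuclideanSpace ℝ (Fin d))}
    {ψ : EuclideanSpace ℝ (Fin d) → F} (h : IsTest Ω' ψ) (hΩ : Bornology.IsBounded Ω) :
    HasH1Grad Ω ψ (classicalGrad ψ) := hasH1Grad_of_contDiff hΩ h.1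

omit [NormedSpace ℝ F] in
theorem tendsto_eLpNorm_grad_apply {α : Type*} [MeasurableSpace α] {m : Measure α}
    {D : ℕ → α → Grad d F} {Dlim : α → Grad d F}
    (h : Tendsto (fun k => eLpNorm (D k - Dlim) 2 m) atTop (𝓝 0)) (j : Fin d) :
    Tendsto (fun k => eLpNorm ((fun x => D k x j) - fun x => Dlim x j) 2 m) atTop (𝓝 0) :=
  tendsto_of_tendsto_of_tendsto_of_le_of_le tendsto_const_nhds h (fun _ => zero_le)
    fun k => eLpNorm_mono fun x => norm_grad_apply_le (D k x - Dlim x) j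

/-- A limit of test functions in the `H¹` norm is in `H¹₀`. -/
theorem hasH10Grad_of_tendsto [CompleteSpace F] {Ω : Set (EuclideanSpace ℝ (Fin d))}
    (hΩ : Bornology.IsBounded Ω)
    {u : EuclideanSpace ℝ (Fin d) → F} {Du : EuclideanSpace ℝ (Fin d) → Grad d F}
    (hu : MemLp u 2 (volume.restrict Ω)) (hDu : MemLp Du 2 (volume.restrict Ω))
    {φ : ℕ → EuclideanSpace ℝ (Fin d) → F} (hφ : ∀ k, IsTest Ω (φ k))
    (h : Tendsto (fun k => eLpNorm (φ k - u) 2 (volume.restrict Ω)) atTop (𝓝 0))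
    (hD : Tendsto (fun k => eLpNorm (classicalGrad (φ k) - Du) 2 (volume.restrict Ω)) atTop (𝓝 0)) :
    HasH10Grad Ω u Du := by
  refine ⟨⟨hu, hDu, fun ψ hψ j => ?_⟩, φ, hφ, h, hD⟩
  have h1 := tendsto_integral_smul (memLp_grad_apply (hψ.memLp_classicalGrad _) j)
    (fun k => (hφ k).memLp _) hu h
  have h2 := tendsto_integral_smul (hψ.memLp (volume.restrict Ω))
    (fun k => memLp_grad_apply ((hφ k).memLp_classicalGrad _) j) (memLp_grad_apply hDu j)
    (tendsto_eLpNorm_grad_apply hD j)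
  refine tendsto_nhds_unique h1 (h2.neg.congr fun k => ?_)
  exact (((hφ k).hasH1Grad hΩ).2.2 ψ hψ j).symm

/-- Integration by parts between `H¹₀(Ω)` and `H¹(Ω)`. -/
theorem HasH10Grad.integral_smul {n : ℕ} {Ω : Set (EuclideanSpace ℝ (Fin d))}
    {u : EuclideanSpace ℝ (Fin d) → EuclideanSpace ℝ (Fin n)}
    {Du : EuclideanSpace ℝ (Fin d) → Grad d (EuclideanSpace ℝ (Fin n))} (hu : HasH10Grad Ω u Du)
    {ψ : EuclideanSpace ℝ (Fin d) → ℝ} {Dψ : EuclideanSpace ℝ (Fin d) → Grad d ℝ}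
    (hψ : HasH1Grad Ω ψ Dψ) (j : Fin d) :
    ∫ x in Ω, Dψ x j • u x = -∫ x in Ω, ψ x • Du x j := by
  obtain ⟨⟨hu, hDu, -⟩, φ, hφ, h, hD⟩ := hu
  have h1 := tendsto_integral_smul (memLp_grad_apply hψ.2.1 j) (fun k => (hφ k).memLp _) hu h
  have h2 := tendsto_integral_smul hψ.1
    (fun k => memLp_grad_apply ((hφ k).memLp_classicalGrad _) j) (memLp_grad_apply hDu j)
    (tendsto_eLpNorm_grad_apply hD j)
  refine tendsto_nhds_unique h1 (h2.neg.congr fun k => ?_)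
  have i1 := integrable_smul_of_memLp (memLp_grad_apply hψ.2.1 j)
    ((hφ k).memLp (volume.restrict Ω))
  have i2 := integrable_smul_of_memLp hψ.1
    (memLp_grad_apply ((hφ k).memLp_classicalGrad (volume.restrict Ω)) j)
  ext i
  have p1 := (EuclideanSpace.proj (𝕜 := ℝ) i).integral_comp_comm i1
  have p2 := (EuclideanSpace.proj (𝕜 := ℝ) i).integral_comp_comm i2
  simp only [PiLp.proj_apply, PiLp.smul_apply, smul_eq_mul] at p1 p2
  rw [PiLp.neg_apply, ← p1, ← p2]
  -- For the approximants the roles are exchanged: each component of `φ k` serves as scalar test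
  -- function in the definition of the weak gradient of `ψ`.
  have hφi : IsTest Ω (fun x => φ k x i) := by
    refine ⟨(EuclideanSpace.proj (𝕜 := ℝ) i).contDiff.comp (hφ k).1,
      (hφ k).2.1.comp_left (g := fun y : EuclideanSpace ℝ (Fin n) => y i) rfl, ?_⟩
    exact (closure_mono (Function.support_comp_subset
      (g := fun y : EuclideanSpace ℝ (Fin n) => y i) rfl (φ k))).trans (hφ k).2.2
  have e : ∀ x, classicalGrad (fun x => φ k x i) x j = classicalGrad (φ k) x j i := by
    intro x
    have := ((EuclideanSpace.proj (𝕜 := ℝ) i).hasFDerivAt.comp x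
      (((hφ k).1.differentiable (by simp)) x).hasFDerivAt).fderiv
    rw [classicalGrad_apply, classicalGrad_apply]
    exact congrArg (fun L => L (EuclideanSpace.single j 1)) this
  have := hψ.2.2 _ hφi j
  simp only [e, smul_eq_mul] at this
  simp only [mul_comm (ψ _), mul_comm (Dψ _ j)]
  rw [this, neg_neg]

end Sobolev

/-! ### The Poincaré inequality -/

section Poincare

variable {d : ℕ} {F : Type*} [NormedAddCommGroup F] [InnerProductSpace ℝ F]

theorem integral_inner_le_of_memLp {α : Type*} [MeasurableSpace α] {m : Measure α} {u v : α → F}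
    (hu : MemLp u 2 m) (hv : MemLp v 2 m) :
    ∫ x, ⟪u x, v x⟫_ℝ ∂m ≤ (eLpNorm u 2 m).toReal * (eLpNorm v 2 m).toReal := by
  have h := real_inner_le_norm (hu.toLp u) (hv.toLp v)
  rw [L2.inner_def, Lp.norm_toLp, Lp.norm_toLp] at h
  convert h using 1
  refine integral_congr_ae ?_
  filter_upwards [hu.coeFn_toLp, hv.coeFn_toLp] with x h1 h2
  rw [h1, h2]

theorem integral_inner_self_of_memLp {α : Type*} [MeasurableSpace α] {m : Measure α} {u : α → F}
    (hu : MemLp u 2 m) : ∫ x, ⟪u x, u x⟫_ℝ ∂m = (eLpNorm u 2 m).toReal ^ 2 := by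
  have h := real_inner_self_eq_norm_sq (hu.toLp u)
  rw [L2.inner_def, Lp.norm_toLp] at h
  rw [← h]
  refine integral_congr_ae ?_
  filter_upwards [hu.coeFn_toLp] with x h1
  rw [h1]

/-- Since `∂ⱼxⱼ = 1`, integrating `|φ|²` by parts gives `∫ |φ|² = -∫ 2 xⱼ φ · ∂ⱼφ`, and
Cauchy–Schwarz with `|xⱼ| ≤ M` yields the constant `2 M`. -/
theorem IsTest.poincare {Ω : Set (EuclideanSpace ℝ (Fin d))}
    {φ : EuclideanSpace ℝ (Fin d) → F} (hφ : IsTest Ω φ) (j : Fin d) {M : ℝ} (hM0 : 0 ≤ M)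
    (hM : ∀ x ∈ Ω, |x j| ≤ M) :
    (eLpNorm φ 2 volume).toReal ≤
      2 * M * (eLpNorm (fun x => classicalGrad φ x j) 2 volume).toReal := by
  have hd := (hφ.1.differentiable (by simp))
  set e : EuclideanSpace ℝ (Fin d) := EuclideanSpace.single j 1
  have hc : Continuous (fun x => fderiv ℝ φ x e) :=
    (hφ.1.continuous_fderiv (by simp)).clm_apply continuous_const
  have hsupp : HasCompactSupport (fun x => ⟪φ x, φ x⟫_ℝ) :=
    hφ.2.1.comp_left (g := fun y : F => ⟪y, y⟫_ℝ) (by simp)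
  have hdq : Differentiable ℝ (fun x => ⟪φ x, φ x⟫_ℝ) := fun x => (hd x).inner ℝ (hd x)
  have hq : ∀ x, fderiv ℝ (fun x => ⟪φ x, φ x⟫_ℝ) x e = 2 * ⟪φ x, fderiv ℝ φ x e⟫_ℝ := by
    intro x
    rw [fderiv_inner_apply ℝ (hd x) (hd x), real_inner_comm (φ x)]
    ring
  have hs2 : HasCompactSupport (fun x => ⟪φ x, fderiv ℝ φ x e⟫_ℝ) := by
    refine hφ.2.1.mono fun x hx => ?_
    contrapose! hx
    simp only [Function.mem_support, not_not] at hx ⊢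
    simp [hx]
  have hcoord : ∀ x : EuclideanSpace ℝ (Fin d),
      fderiv ℝ (fun x : EuclideanSpace ℝ (Fin d) => x j) x e = 1 := by
    intro x
    have := (EuclideanSpace.proj (𝕜 := ℝ) j : EuclideanSpace ℝ (Fin d) →L[ℝ] ℝ).fderiv (x := x)
    have h2 : fderiv ℝ (fun x : EuclideanSpace ℝ (Fin d) => x j) x
      = (EuclideanSpace.proj (𝕜 := ℝ) j : EuclideanSpace ℝ (Fin d) →L[ℝ] ℝ) := this
    rw [h2]; simp [e]
  have hcj : Continuous (fun x : EuclideanSpace ℝ (Fin d) => x j) := by fun_prop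
  have hφφ : Continuous (fun x => ⟪φ x, φ x⟫_ℝ) := hφ.1.continuous.inner hφ.1.continuous
  have hφc : Continuous (fun x => ⟪φ x, fderiv ℝ φ x e⟫_ℝ) := hφ.1.continuous.inner hc
  have key := integral_mul_fderiv_eq_neg_fderiv_mul_of_integrable (μ := volume)
    (f := fun x : EuclideanSpace ℝ (Fin d) => x j) (g := fun x => ⟪φ x, φ x⟫_ℝ) (v := e)
    (by simp only [hcoord, one_mul]; exact hφφ.integrable_of_hasCompactSupport hsupp)
    (by
      simp only [hq]
      exact (hcj.mul (continuous_const.mul hφc)).integrable_of_hasCompactSupport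
        (hs2.mul_left.mul_left))
    ((hcj.mul hφφ).integrable_of_hasCompactSupport hsupp.mul_left)
    (fun x _ => by fun_prop) (fun x _ => hdq x)
  simp only [hcoord, hq, one_mul] at key
  have m1 := hφ.memLp volume
  have m2 := memLp_grad_apply (hφ.memLp_classicalGrad volume) j
  have hsq := integral_inner_self_of_memLp m1
  have hle : (eLpNorm φ 2 volume).toReal ^ 2 ≤ (eLpNorm φ 2 volume).toReal *
      (2 * M * (eLpNorm (fun x => classicalGrad φ x j) 2 volume).toReal) := by
    have m3 : MemLp (fun x => (-(2 * x j)) • fderiv ℝ φ x e) 2 volume := by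
      refine Continuous.memLp_of_hasCompactSupport (by fun_prop) ?_
      exact (hφ.2.1.fderiv_apply ℝ e).smul_left
    have e1 : ∫ x, ⟪φ x, φ x⟫_ℝ = ∫ x, ⟪φ x, (-(2 * x j)) • fderiv ℝ φ x e⟫_ℝ := by
      rw [← neg_neg (∫ x, ⟪φ x, φ x⟫_ℝ), ← key, ← integral_neg]
      congr 1 with x
      rw [inner_smul_right]; ring
    rw [← hsq, e1]
    refine (integral_inner_le_of_memLp m1 m3).trans ?_
    refine mul_le_mul_of_nonneg_left ?_ ENNReal.toReal_nonneg
    have : eLpNorm (fun x => (-(2 * x j)) • fderiv ℝ φ x e) 2 volume ≤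
        ENNReal.ofReal (2 * M) * eLpNorm (fun x => classicalGrad φ x j) 2 volume := by
      refine eLpNorm_le_mul_eLpNorm_of_ae_le_mul (ae_of_all _ fun x => ?_) _
      rw [norm_smul, norm_neg, norm_mul, Real.norm_two, Real.norm_eq_abs]
      -- The bound on `|xⱼ|` is available only in `Ω`; elsewhere the derivative vanishes.
      by_cases h0 : fderiv ℝ φ x e = 0
      · rw [classicalGrad_apply, h0]; simp
      · have hx : x ∈ Ω := hφ.2.2 (tsupport_fderiv_apply_subset ℝ e (subset_tsupport _ h0))
        rw [classicalGrad_apply]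
        gcongr
        exact hM x hx
    refine (ENNReal.toReal_mono (ENNReal.mul_ne_top ENNReal.ofReal_ne_top m2.2.ne) this).trans ?_
    rw [ENNReal.toReal_mul, ENNReal.toReal_ofReal (by positivity)]
  rcases (ENNReal.toReal_nonneg (a := eLpNorm φ 2 volume)).eq_or_lt with h0 | h0
  · rw [← h0]
    positivity
  · rw [sq] at hle
    exact le_of_mul_le_mul_left hle h0

theorem eLpNorm_restrict_of_tsupport {E F : Type*} [TopologicalSpace E] [MeasurableSpace E]
    [NormedAddCommGroup F] {m : Measure E} {Ω : Set E} (hΩ : MeasurableSet Ω) {φ : E → F}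
    (h : tsupport φ ⊆ Ω) : eLpNorm φ 2 (m.restrict Ω) = eLpNorm φ 2 m := by
  rw [← eLpNorm_indicator_eq_eLpNorm_restrict hΩ, Set.indicator_eq_self.2]
  exact (subset_tsupport φ).trans h

theorem tendsto_toReal_eLpNorm {α F : Type*} [MeasurableSpace α] [NormedAddCommGroup F]
    {m : Measure α} {u : ℕ → α → F} {v : α → F}
    (hu : ∀ k, MemLp (u k) 2 m) (hv : MemLp v 2 m)
    (h : Tendsto (fun k => eLpNorm (u k - v) 2 m) atTop (𝓝 0)) :
    Tendsto (fun k => (eLpNorm (u k) 2 m).toReal) atTop (𝓝 (eLpNorm v 2 m).toReal) := by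
  simp_rw [← Lp.norm_toLp v hv, ← fun k => Lp.norm_toLp (u k) (hu k)]
  exact ((Lp.tendsto_Lp_iff_tendsto_eLpNorm'' u hu v hv).2 h).norm

/-- The Poincaré inequality in a set bounded in one direction. -/
theorem HasH10Grad.poincare [CompleteSpace F] {Ω : Set (EuclideanSpace ℝ (Fin d))}
    (hΩ : MeasurableSet Ω)
    {u : EuclideanSpace ℝ (Fin d) → F} {Du : EuclideanSpace ℝ (Fin d) → Grad d F}
    (hu : HasH10Grad Ω u Du) (j : Fin d) {M : ℝ} (hM0 : 0 ≤ M)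
    (hM : ∀ x ∈ Ω, |x j| ≤ M) :
    (eLpNorm u 2 (volume.restrict Ω)).toReal ≤
      2 * M * (eLpNorm (fun x => Du x j) 2 (volume.restrict Ω)).toReal := by
  obtain ⟨⟨hu, hDu, -⟩, φ, hφ, h, hD⟩ := hu
  refine le_of_tendsto_of_tendsto' (tendsto_toReal_eLpNorm (fun k => (hφ k).memLp _) hu h)
    ((tendsto_toReal_eLpNorm (fun k => memLp_grad_apply ((hφ k).memLp_classicalGrad _) j)
      (memLp_grad_apply hDu j) (tendsto_eLpNorm_grad_apply hD j)).const_mul (2 * M)) fun k => ?_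
  rw [eLpNorm_restrict_of_tsupport hΩ (hφ k).2.2, eLpNorm_restrict_of_tsupport hΩ]
  · exact (hφ k).poincare j hM0 hM
  · exact (tsupport_fderiv_apply_subset ℝ _).trans (hφ k).2.2

end Poincare

/-! ### Square integrable functions on a product as `L²`-valued functions -/

section Curry

variable {α β F : Type*} [MeasurableSpace α] [MeasurableSpace β] [NormedAddCommGroup F]
  {ν : Measure α} {m : Measure β} [SFinite m]

theorem eLpNorm_two_rpow {γ E : Type*} [MeasurableSpace γ] [NormedAddCommGroup E]
    (m : Measure γ) (f : γ → E) : eLpNorm f 2 m ^ (2 : ℝ) = ∫⁻ x, ‖f x‖ₑ ^ (2 : ℝ) ∂m := by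
  rw [eLpNorm_eq_lintegral_rpow_enorm_toReal (by simp) (by simp), ← ENNReal.rpow_mul]
  simp

theorem eLpNorm_two_eq {γ E : Type*} [MeasurableSpace γ] [NormedAddCommGroup E]
    (m : Measure γ) (f : γ → E) :
    eLpNorm f 2 m = (∫⁻ x, ‖f x‖ₑ ^ (2 : ℝ) ∂m) ^ (1 / 2 : ℝ) := by
  rw [eLpNorm_eq_lintegral_rpow_enorm_toReal (by simp) (by simp)]
  simp

/-- By the Lindelöf property an open set is a countable union of balls, and the preimage of a ball
is a sublevel set of a distance function. For a curried function these distances are integrals over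
slices, measurable by Tonelli. -/
theorem measurable_of_measurable_edist {γ X : Type*} [MeasurableSpace γ] [PseudoEMetricSpace X]
    [SecondCountableTopology X] [MeasurableSpace X] [BorelSpace X] {f : γ → X}
    (h : ∀ c, Measurable fun t => edist (f t) c) : Measurable f := by
  refine measurable_of_isOpen fun U hU => ?_
  have hball : ∀ c : U, ∃ r > 0, Metric.eball (c : X) r ⊆ U :=
    fun c => EMetric.isOpen_iff.1 hU c c.2
  choose r hr hrU using hball
  obtain ⟨T, hT, hTU⟩ := TopologicalSpace.isOpen_iUnion_countable
    (fun c : U => Metric.eball (c : X) (r c)) fun c => Metric.isOpen_eball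
  have : U = ⋃ c ∈ T, Metric.eball (c : X) (r c) := by
    rw [hTU]
    refine Set.Subset.antisymm (fun x hx => ?_) (Set.iUnion_subset hrU)
    exact Set.mem_iUnion.2 ⟨⟨x, hx⟩, Metric.mem_eball_self (hr _)⟩
  rw [this, Set.preimage_iUnion₂]
  exact MeasurableSet.biUnion hT fun c _ => measurableSet_lt (h c) measurable_const

/-- Curried square integrable functions have the same norm. -/
theorem eLpNorm_curry {W : α → Lp F 2 m} {w : α × β → F} (hw : AEStronglyMeasurable w (ν.prod m))
    (h : ∀ᵐ t ∂ν, ∀ᵐ x ∂m, W t x = w (t, x)) : eLpNorm W 2 ν = eLpNorm w 2 (ν.prod m) := by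
  rw [eLpNorm_two_eq, eLpNorm_two_eq, lintegral_prod _ (hw.enorm.pow_const _)]
  congr 1
  refine lintegral_congr_ae ?_
  filter_upwards [h] with t ht
  rw [Lp.enorm_def, eLpNorm_two_rpow]
  refine lintegral_congr_ae ?_
  filter_upwards [ht] with x hx
  rw [hx]

/-- By Tonelli almost every slice of a measurable representative is square integrable. Separability
of `L²` reduces measurability of the slice map to that of its distances to fixed elements. -/
theorem exists_curry [SecondCountableTopology (Lp F 2 m)] {w : α × β → F}
    (hw : MemLp w 2 (ν.prod m)) :
    ∃ W : Lp (Lp F 2 m) 2 ν, ∀ᵐ t ∂ν, ∀ᵐ x ∂m, W t x = w (t, x) := by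
  classical
  obtain ⟨w', hw', hww'⟩ := hw.1
  have hmeas : ∀ t, StronglyMeasurable fun x => w' (t, x) :=
    fun t => hw'.comp_measurable measurable_prodMk_left
  have hfin : ∀ᵐ t ∂ν, MemLp (fun x => w' (t, x)) 2 m := by
    have h1 : ∫⁻ t, ∫⁻ x, ‖w' (t, x)‖ₑ ^ (2 : ℝ) ∂m ∂ν ≠ ⊤ := by
      rw [← lintegral_prod _ (hw'.enorm.pow_const _).aemeasurable,
        ← eLpNorm_two_rpow (ν.prod m) w']
      exact ENNReal.rpow_ne_top_of_nonneg (by norm_num) (hw.ae_eq hww').2.ne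
    filter_upwards [ae_lt_top ((hw'.enorm.pow_const _).lintegral_prod_right') h1] with t ht
    refine ⟨(hmeas t).aestronglyMeasurable, ?_⟩
    rw [eLpNorm_two_eq]
    exact ENNReal.rpow_lt_top_of_nonneg (by norm_num) ht.ne
  set V : α → Lp F 2 m :=
    fun t => if h : MemLp (fun x => w' (t, x)) 2 m then h.toLp _ else 0 with hV
  let _ : MeasurableSpace (Lp F 2 m) := borel _
  have _ : BorelSpace (Lp F 2 m) := ⟨rfl⟩
  have hdist : ∀ c : β → F, StronglyMeasurable c →
      Measurable fun t => eLpNorm (fun x => w' (t, x) - c x) 2 m := by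
    intro c hc
    simp only [eLpNorm_two_eq]
    have : StronglyMeasurable fun p : α × β => w' p - c p.2 :=
      hw'.sub (hc.comp_measurable measurable_snd)
    exact (this.enorm.pow_const _).lintegral_prod_right'.pow_const _
  have hVm : Measurable V := by
    refine measurable_of_measurable_edist fun c => ?_
    obtain ⟨c', hc', hcc'⟩ := (Lp.memLp c).1
    -- Slices outside `L²` are sent to `0`. They are the parameters at which the measurable function
    -- `t ↦ ‖w'(t, ·)‖` is infinite, so the case distinction is measurable.
    have e : (fun t => edist (V t) c) = fun t =>
        if eLpNorm (fun x => w' (t, x) - (0 : β → F) x) 2 m < ⊤ then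
          eLpNorm (fun x => w' (t, x) - c' x) 2 m else edist 0 c := by
      ext t
      by_cases h : MemLp (fun x => w' (t, x)) 2 m
      · have h2 : eLpNorm (fun x => w' (t, x) - (0 : β → F) x) 2 m < ⊤ := by simpa using h.2
        rw [if_pos h2]
        simp only [hV, dif_pos h]
        rw [Lp.edist_def]
        refine eLpNorm_congr_ae ?_
        filter_upwards [h.coeFn_toLp, hcc'] with x h3 h4
        simp [h3, h4]
      · have h2 : ¬ eLpNorm (fun x => w' (t, x) - (0 : β → F) x) 2 m < ⊤ := fun h' =>
          h ⟨(hmeas t).aestronglyMeasurable, by simpa using h'⟩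
        rw [if_neg h2]
        simp only [hV, dif_neg h]
    rw [e]
    exact Measurable.ite (measurableSet_lt (hdist 0 stronglyMeasurable_zero) measurable_const)
      (hdist c' hc') measurable_const
  have hVw : ∀ᵐ t ∂ν, ∀ᵐ x ∂m, V t x = w (t, x) := by
    filter_upwards [hfin, Measure.ae_ae_of_ae_prod hww'] with t ht h2
    simp only [hV, dif_pos ht]
    filter_upwards [ht.coeFn_toLp, h2] with x h3 h4
    rw [h3, h4]
  have hVL : MemLp V 2 ν :=
    ⟨hVm.stronglyMeasurable.aestronglyMeasurable, by rw [eLpNorm_curry hw.1 hVw]; exact hw.2⟩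
  refine ⟨hVL.toLp V, ?_⟩
  filter_upwards [hVw, hVL.coeFn_toLp] with t h1 h2
  rw [h2]
  exact h1

variable [SFinite ν]

omit [SFinite ν] [SFinite m] in
theorem memLp_two_mul_prod {a : α → ℝ} {b : β → ℝ} (ha : MemLp a 2 ν) (hb : MemLp b 2 m) :
    MemLp (fun p : α × β => a p.1 * b p.2) 2 (ν.prod m) := by
  have hm : AEStronglyMeasurable (fun p : α × β => a p.1 * b p.2) (ν.prod m) :=
    ha.1.comp_fst.mul hb.1.comp_snd
  rw [memLp_two_iff_integrable_sq hm]
  simp only [mul_pow]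
  exact ha.integrable_sq.mul_prod hb.integrable_sq

variable [NormedSpace ℝ F] [CompleteSpace F]

/-- The Fubini theorem for weighted integrals of curried functions. -/
theorem smulIntegral_curry {W : Lp (Lp F 2 m) 2 ν} {w : α × β → F} (hw : MemLp w 2 (ν.prod m))
    (h : ∀ᵐ t ∂ν, ∀ᵐ x ∂m, W t x = w (t, x)) {a : α → ℝ} {b : β → ℝ}
    (ha : MemLp a 2 ν) (hb : MemLp b 2 m) :
    smulIntegral hb (smulIntegral ha W) = ∫ p, (a p.1 * b p.2) • w p ∂(ν.prod m) := by
  rw [smulIntegral_apply ha, ← (smulIntegral hb).integral_comp_comm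
    (integrable_smul_of_memLp ha (Lp.memLp W)),
    integral_prod _ (integrable_smul_of_memLp (memLp_two_mul_prod ha hb) hw)]
  refine integral_congr_ae ?_
  filter_upwards [h] with t ht
  simp only [map_smul, mul_smul]
  rw [smulIntegral_apply, integral_smul]
  congr 1
  refine integral_congr_ae ?_
  filter_upwards [ht] with x hx
  rw [hx]

end Curry

/-! ### Cylinders over the unit square -/

theorem hat_apply_zero (x : E3) : hat x 0 = x 0 := rfl

theorem hat_apply_one (x : E3) : hat x 1 = x 1 := rfl

@[simp] theorem hat_join (x : E2) (t : ℝ) : hat (join x t) = x := by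
  ext i
  fin_cases i <;> rfl

@[simp] theorem join_two (x : E2) (t : ℝ) : join x t 2 = t := rfl

theorem join_hat (x : E3) : join (hat x) (x 2) = x := by
  ext i
  fin_cases i <;> rfl

/-- The identification of `ℝ × ℝ²` with `ℝ³`, the first factor being the vertical axis. -/
def joinEquiv : (ℝ × E2) ≃L[ℝ] E3 :=
  LinearEquiv.toContinuousLinearEquiv
    { toFun := fun p => join p.2 p.1
      map_add' := fun p q => by ext i; fin_cases i <;> simp [join]
      map_smul' := fun c p => by ext i; fin_cases i <;> simp [join]
      invFun := fun x => (x 2, hat x)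
      left_inv := fun p => by simp
      right_inv := fun x => join_hat x }

@[simp] theorem joinEquiv_apply (p : ℝ × E2) : joinEquiv p = join p.2 p.1 := rfl

theorem measurableEmbedding_joinEquiv : MeasurableEmbedding joinEquiv :=
  joinEquiv.toHomeomorph.measurableEmbedding

/-- Up to the measure-preserving identification of Euclidean space with a product, this is the
insertion of a last coordinate. -/
theorem measurePreserving_joinEquiv :
    MeasurePreserving joinEquiv ((volume : Measure ℝ).prod (volume : Measure E2)) volume := by
  have h1 := (MeasurePreserving.id (volume : Measure ℝ)).prod (PiLp.volume_preserving_ofLp (Fin 2))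
  have h2 := (volume_preserving_piFinSuccAbove (fun _ : Fin 3 => ℝ) (Fin.last 2)).symm
  have h3 := (PiLp.volume_preserving_toLp (Fin 3)).comp (h2.comp h1)
  have e : (joinEquiv : ℝ × E2 → E3) = fun p => WithLp.toLp 2
      ((MeasurableEquiv.piFinSuccAbove (fun _ : Fin 3 => ℝ) (Fin.last 2)).symm
        (Prod.map id WithLp.ofLp p)) := by
    refine funext fun p => PiLp.ext fun i => ?_
    fin_cases i <;> rfl
  rw [e]
  exact h3

theorem isOpen_omega : IsOpen omega := by
  have : omega = ⋂ i : Fin 2, {x : E2 | 0 < x i ∧ x i < 1} := by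
    ext x; simp [omega]
  rw [this]
  refine isOpen_iInter_of_finite fun i => ?_
  have hc : Continuous fun x : E2 => x i := by fun_prop
  exact (isOpen_lt continuous_const hc).inter (isOpen_lt hc continuous_const)

theorem isBounded_of_forall_abs_le {d : ℕ} {s : Set (EuclideanSpace ℝ (Fin d))} {R : ℝ}
    (h : ∀ x ∈ s, ∀ i, |x i| ≤ R) : Bornology.IsBounded s := by
  refine isBounded_iff_forall_norm_le.2 ⟨∑ _i : Fin d, R, fun x hx => ?_⟩
  refine (EuclideanSpace.norm_eq x).le.trans ?_
  have h0 : ∀ i, 0 ≤ R := fun i => (abs_nonneg _).trans (h x hx i)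
  refine Real.sqrt_le_iff.2 ⟨Finset.sum_nonneg fun i _ => h0 i, ?_⟩
  refine le_trans ?_ (Finset.sum_sq_le_sq_sum_of_nonneg fun i _ => h0 i)
  refine Finset.sum_le_sum fun i _ => ?_
  rw [Real.norm_eq_abs]
  exact pow_le_pow_left₀ (abs_nonneg _) (h x hx i) 2

theorem isBounded_omega : Bornology.IsBounded omega :=
  isBounded_of_forall_abs_le (R := 1) fun x hx i => abs_le.2 ⟨by linarith [(hx i).1], (hx i).2.le⟩

instance : IsFiniteMeasure (volume.restrict omega) :=
  isFiniteMeasure_restrict.2 isBounded_omega.measure_lt_top.ne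

theorem isBounded_fixedDomain (h : ℝ) : Bornology.IsBounded (fixedDomain h) := by
  refine isBounded_of_forall_abs_le (R := max 1 h) fun x hx i => ?_
  have h0 := hx.1 0
  have h1 := hx.1 1
  rw [hat_apply_zero] at h0
  rw [hat_apply_one] at h1
  fin_cases i
  · exact le_max_of_le_left (abs_le.2 ⟨by simp; linarith, by simp; linarith⟩)
  · exact le_max_of_le_left (abs_le.2 ⟨by simp; linarith, by simp; linarith⟩)
  · exact le_max_of_le_right (abs_le.2 ⟨by simp; linarith [hx.2.1, hx.2.2], by simp; exact hx.2.2.le⟩)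

theorem isOpen_fixedDomain (h : ℝ) : IsOpen (fixedDomain h) := by
  have hc : Continuous fun x : E3 => x 2 := by fun_prop
  exact (isOpen_omega.preimage hat.continuous).inter
    ((isOpen_lt continuous_const hc).inter (isOpen_lt hc continuous_const))

theorem measurePreserving_joinEquiv_fixedDomain (h : ℝ) :
    MeasurePreserving joinEquiv
      ((volume.restrict (Set.Ioo 0 h)).prod (volume.restrict omega))
      (volume.restrict (fixedDomain h)) := by
  rw [Measure.prod_restrict]
  have := measurePreserving_joinEquiv.restrict_preimage_emb measurableEmbedding_joinEquiv
    (fixedDomain h)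
  convert this using 2
  ext p
  simp only [Set.mem_prod, Set.mem_Ioo, fixedDomain, Set.mem_preimage, joinEquiv_apply,
    Set.mem_ofPred_eq, hat_join, join_two]
  tauto

theorem memLp_comp_joinEquiv {F : Type*} [NormedAddCommGroup F] {h : ℝ} {w : E3 → F}
    (hw : MemLp w 2 (volume.restrict (fixedDomain h))) :
    MemLp (fun p => w (joinEquiv p)) 2
      ((volume.restrict (Set.Ioo 0 h)).prod (volume.restrict omega)) :=
  hw.comp_measurePreserving (measurePreserving_joinEquiv_fixedDomain h)

instance : SecondCountableTopology L2omega3 := by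
  have : Fact ((2 : ENNReal) ≠ ⊤) := ⟨by simp⟩
  exact Lp.SecondCountableTopology

section Cylinder

variable {h : ℝ}

theorem exists_curry_fixedDomain {w : E3 → E3} (hw : MemLp w 2 (volume.restrict (fixedDomain h))) :
    ∃ W : Lp L2omega3 2 (volume.restrict (Set.Ioo 0 h)),
      ∀ᵐ t ∂(volume.restrict (Set.Ioo 0 h)), ∀ᵐ x ∂(volume.restrict omega),
        W t x = w (join x t) :=
  exists_curry (memLp_comp_joinEquiv hw)

theorem norm_curry_fixedDomain {w : E3 → E3} (hw : MemLp w 2 (volume.restrict (fixedDomain h)))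
    {W : Lp L2omega3 2 (volume.restrict (Set.Ioo 0 h))}
    (hW : ∀ᵐ t ∂(volume.restrict (Set.Ioo 0 h)), ∀ᵐ x ∂(volume.restrict omega),
      W t x = w (join x t)) :
    ‖W‖ = (eLpNorm w 2 (volume.restrict (fixedDomain h))).toReal := by
  rw [Lp.norm_def, eLpNorm_curry (memLp_comp_joinEquiv hw).1 hW]
  congr 1
  exact eLpNorm_comp_measurePreserving hw.1 (measurePreserving_joinEquiv_fixedDomain h)

theorem smulIntegral_curry_fixedDomain {w : E3 → E3}
    (hw : MemLp w 2 (volume.restrict (fixedDomain h)))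
    {W : Lp L2omega3 2 (volume.restrict (Set.Ioo 0 h))}
    (hW : ∀ᵐ t ∂(volume.restrict (Set.Ioo 0 h)), ∀ᵐ x ∂(volume.restrict omega),
      W t x = w (join x t))
    {a : ℝ → ℝ} {b : E2 → ℝ} (ha : MemLp a 2 (volume.restrict (Set.Ioo 0 h)))
    (hb : MemLp b 2 (volume.restrict omega)) :
    smulIntegral hb (smulIntegral ha W) =
      ∫ x in fixedDomain h, (a (x 2) * b (hat x)) • w x := by
  rw [smulIntegral_curry (memLp_comp_joinEquiv hw) hW ha hb,
    ← (measurePreserving_joinEquiv_fixedDomain h).integral_comp measurableEmbedding_joinEquiv]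
  simp

/-- The gradient of a function of the horizontal variables. -/
def liftGrad (D : Grad 2 ℝ) : Grad 3 ℝ := !₂[D 0, D 1, 0]

theorem memLp_comp_hat {F : Type*} [NormedAddCommGroup F] {f : E2 → F}
    (hf : MemLp f 2 (volume.restrict omega)) :
    MemLp (fun x => f (hat x)) 2 (volume.restrict (fixedDomain h)) := by
  have hJ := measurePreserving_joinEquiv_fixedDomain h
  have : MemLp (fun p : ℝ × E2 => f p.2) 2
    ((volume.restrict (Set.Ioo 0 h)).prod (volume.restrict omega)) := hf.comp_snd _
  rw [← hJ.map_eq, measurableEmbedding_joinEquiv.memLp_map_measure_iff]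
  simpa [Function.comp_def] using this

/-- `H¹` functions of the horizontal variables are `H¹` functions in the cylinder. -/
theorem HasH1Grad.comp_hat {ψ : E2 → ℝ} {Dψ : E2 → Grad 2 ℝ} (hψ : HasH1Grad omega ψ Dψ) :
    HasH1Grad (fixedDomain h) (fun x => ψ (hat x)) (fun x => liftGrad (Dψ (hat x))) := by
  have hD : MemLp (fun x => liftGrad (Dψ x)) 2 (volume.restrict omega) := by
    refine hψ.2.1.mono ?_ (ae_of_all _ fun x => ?_)
    · have : Continuous liftGrad := by unfold liftGrad; fun_prop
      exact this.comp_aestronglyMeasurable hψ.2.1.1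
    · simp [liftGrad, EuclideanSpace.norm_eq, Fin.sum_univ_succ]
  refine ⟨memLp_comp_hat hψ.1, memLp_comp_hat (f := fun x => liftGrad (Dψ x)) hD,
    fun φ hφ j => ?_⟩
  have hJ := measurePreserving_joinEquiv_fixedDomain h
  set ν := volume.restrict (Set.Ioo 0 h)
  set m := volume.restrict omega
  have hi1 := memLp_comp_joinEquiv
    (memLp_grad_apply (hφ.memLp_classicalGrad (volume.restrict (fixedDomain h))) j)
  have hi2 := memLp_comp_joinEquiv (hφ.memLp (volume.restrict (fixedDomain h)))
  have hψ' := memLp_comp_joinEquiv (memLp_comp_hat (h := h) hψ.1)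
  have hD' := memLp_comp_joinEquiv (memLp_grad_apply (memLp_comp_hat (h := h) hD) j)
  have I1 := integrable_smul_of_memLp hi1 hψ'
  have I2 := integrable_smul_of_memLp hi2 hD'
  rw [← hJ.integral_comp measurableEmbedding_joinEquiv,
    ← hJ.integral_comp measurableEmbedding_joinEquiv]
  have hdφ : ∀ x, HasFDerivAt φ (fderiv ℝ φ x) x := fun x =>
    ((hφ.1.differentiable (by simp)) x).hasFDerivAt
  have hslice : ∀ t : ℝ, ContDiff ℝ ∞ fun y : E2 => φ (joinEquiv (t, y)) := fun t =>
    hφ.1.comp (joinEquiv.contDiff.comp (contDiff_prodMk_right t))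
  -- Horizontal slices of a test function on the cylinder are test functions on `ω`, so the weak
  -- gradient of `ψ` can be used at each height separately.
  have htest : ∀ t : ℝ, IsTest omega fun y : E2 => φ (joinEquiv (t, y)) := by
    intro t
    have hsub : tsupport (fun y : E2 => φ (joinEquiv (t, y))) ⊆
        (fun y => joinEquiv (t, y)) ⁻¹' tsupport φ :=
      tsupport_comp_subset_preimage φ (joinEquiv.continuous.comp (by fun_prop))
    refine ⟨hslice t, ?_, hsub.trans fun y hy => ?_⟩
    · refine HasCompactSupport.of_support_subset_isCompact (hφ.2.1.isCompact.image hat.continuous)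
        fun y hy => ⟨_, subset_tsupport φ hy, by simp⟩
    · simpa using (hφ.2.2 hy).1
  have hsingle : ∀ (j : Fin 2) (t : ℝ) (y : E2),
      classicalGrad (fun y : E2 => φ (joinEquiv (t, y))) y j =
        classicalGrad φ (joinEquiv (t, y)) (j.castSucc) := by
    intro j t y
    have e := ((hdφ (joinEquiv (t, y))).comp y ((joinEquiv.hasFDerivAt (x := (t, y))).comp y
      (hasFDerivAt_prodMk_right (𝕜 := ℝ) t y))).fderiv
    have := congrArg (fun L => L (EuclideanSpace.single j 1)) e
    refine this.trans ?_
    rw [classicalGrad_apply]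
    simp only [ContinuousLinearMap.comp_apply]
    congr 1
    ext i
    fin_cases j <;> fin_cases i <;> simp [join]
  have hor : ∀ j : Fin 2, (∀ᵐ t ∂ν, ∫ y, classicalGrad φ (joinEquiv (t, y)) j.castSucc • ψ y ∂m =
      - ∫ y, φ (joinEquiv (t, y)) • Dψ y j ∂m) := by
    intro j
    refine ae_of_all _ fun t => ?_
    rw [← hψ.2.2 _ (htest t) j]
    simp only [hsingle]
    rfl
  have horiz : ∀ j' : Fin 2, j = j'.castSucc → (∀ D : Grad 2 ℝ, liftGrad D j = D j') →
      ∫ p, classicalGrad φ (joinEquiv p) j • ψ (hat (joinEquiv p)) ∂ν.prod m =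
        -∫ p, φ (joinEquiv p) • liftGrad (Dψ (hat (joinEquiv p))) j ∂ν.prod m := by
    rintro j' hj hl
    rw [integral_prod _ I1, integral_prod _ I2, ← integral_neg]
    refine integral_congr_ae ?_
    filter_upwards [hor j'] with t ht
    simp only [hl]
    simpa [hj] using ht
  fin_cases j
  · exact horiz 0 rfl fun D => rfl
  · exact horiz 1 rfl fun D => rfl
  -- In the vertical direction `ψ` is constant along each line, and the derivative of `φ` along that
  -- line integrates to zero by compact support.
  · have : ∀ D : Grad 2 ℝ, liftGrad D 2 = 0 := fun D => rfl
    simp only [Fin.reduceFinMk, this, smul_zero, integral_zero, neg_zero]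
    have I3 : Integrable (fun p => classicalGrad φ (joinEquiv p) 2 • ψ (hat (joinEquiv p)))
      (ν.prod m) := I1
    rw [integral_prod_symm _ I3]
    refine integral_eq_zero_of_ae (ae_of_all _ fun y => ?_)
    simp only [joinEquiv_apply, hat_join, Pi.zero_apply]
    rw [integral_smul_const]
    have hder : ∀ t, HasDerivAt (fun t => φ (join y t)) (classicalGrad φ (join y t) 2) t := by
      intro t
      have e := ((hdφ (joinEquiv (t, y))).comp t ((joinEquiv.hasFDerivAt (x := (t, y))).comp t
        (hasFDerivAt_prodMk_left (𝕜 := ℝ) t y))).hasDerivAt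
      refine e.congr_deriv ?_
      rw [classicalGrad_apply]
      simp only [ContinuousLinearMap.comp_apply]
      congr 1
      ext i
      fin_cases i <;> simp [join]
    have hcsy : HasCompactSupport fun t => φ (join y t) := by
      have hc : Continuous fun x : E3 => x 2 := by fun_prop
      exact HasCompactSupport.of_support_subset_isCompact (hφ.2.1.isCompact.image hc)
        fun t ht => ⟨_, subset_tsupport φ ht, by simp⟩
    have hcont : Continuous fun t => classicalGrad φ (join y t) 2 := by
      have : Continuous fun t => joinEquiv (t, y) := joinEquiv.continuous.comp (by fun_prop)
      have h2 := (continuous_classicalGrad hφ.1).comp this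
      exact (PiLp.continuous_apply 2 _ (2 : Fin 3)).comp h2
    have hz : ∀ t, t ∉ Set.Ioo 0 h → classicalGrad φ (join y t) 2 = 0 := by
      intro t ht
      by_contra hne
      have : join y t ∈ fixedDomain h := hφ.2.2
        (tsupport_fderiv_apply_subset ℝ (EuclideanSpace.single (2 : Fin 3) (1 : ℝ))
          (subset_tsupport _ hne))
      exact ht (by simpa using this.2)
    have : ∫ t, classicalGrad φ (join y t) 2 ∂ν = 0 := by
      rw [setIntegral_eq_integral_of_forall_compl_eq_zero hz]
      have hcs' : HasCompactSupport fun t => classicalGrad φ (join y t) 2 := by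
        have := hcsy.deriv
        rwa [show deriv (fun t => φ (join y t)) = fun t => classicalGrad φ (join y t) 2 from
          funext fun t => (hder t).deriv] at this
      refine integral_eq_zero_of_hasDerivAt_of_integrable hder
        (hcont.integrable_of_hasCompactSupport hcs') ?_
      exact (continuous_iff_continuousAt.2 fun t => (hder t).continuousAt)
        |>.integrable_of_hasCompactSupport hcsy
    rw [this, zero_smul]

end Cylinder

/-! ### Weak compactness -/

theorem weakTendsto_iff {E : Type*} [NormedAddCommGroup E] [NormedSpace ℝ E] {x : ℕ → E} {a : E} :
    WeakTendsto x a ↔ ∀ l : StrongDual ℝ E, Tendsto (fun n => l (x n)) atTop (𝓝 (l a)) := by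
  have h : Topology.IsInducing fun (x : WeakSpace ℝ E) (y : StrongDual ℝ E) =>
    (topDualPairing ℝ E).flip x y := ⟨rfl⟩
  rw [WeakTendsto, h.tendsto_nhds_iff, tendsto_pi_nhds]
  rfl

/-- Bounded sequences in a Hilbert space have weakly convergent subsequences. -/
theorem exists_weakTendsto_of_bounded {H : Type*} [NormedAddCommGroup H] [InnerProductSpace ℝ H]
    [CompleteSpace H] (x : ℕ → H) {R : ℝ} (hx : ∀ n, ‖x n‖ ≤ R) :
    ∃ (s : ℕ → ℕ) (a : H), StrictMono s ∧ WeakTendsto (fun k => x (s k)) a := by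
  -- `H` need not be separable, but the closed span `M` of the sequence is, so the sequential
  -- Banach–Alaoglu theorem applies in the dual of `M`. Riesz representation in `M` turns the weak-*
  -- limit into a vector and handles the restriction to `M` of any functional on `H`.
  set M : Submodule ℝ H := (Submodule.span ℝ (Set.range x)).topologicalClosure with hM
  have hMc : IsClosed (M : Set H) := Submodule.isClosed_topologicalClosure _
  have : CompleteSpace M := hMc.completeSpace_coe
  have hsep : TopologicalSpace.IsSeparable (M : Set H) := by
    rw [hM, Submodule.topologicalClosure_coe]
    exact ((Set.countable_range x).isSeparable.span (R := ℝ)).closure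
  have : TopologicalSpace.SeparableSpace M := hsep.separableSpace
  have hxM : ∀ n, x n ∈ M := fun n =>
    Submodule.le_topologicalClosure _ (Submodule.subset_span ⟨n, rfl⟩)
  let y : ℕ → M := fun n => ⟨x n, hxM n⟩
  have hb : ∀ n, StrongDual.toWeakDual (innerSL ℝ (y n)) ∈
      (WeakDual.toStrongDual ⁻¹' Metric.closedBall (0 : StrongDual ℝ M) R) := by
    intro n
    refine mem_closedBall_zero_iff.2 (?_ : ‖innerSL ℝ (y n)‖ ≤ R)
    rw [innerSL_apply_norm]
    exact hx n
  obtain ⟨F, -, s, hs, hF⟩ := WeakDual.isSeqCompact_closedBall ℝ M 0 R hb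
  rw [tendsto_iff_forall_eval_tendsto_topDualPairing] at hF
  set a : M := (InnerProductSpace.toDual ℝ M).symm (WeakDual.toStrongDual F)
  refine ⟨s, a, hs, weakTendsto_iff.2 fun l => ?_⟩
  set z : M := (InnerProductSpace.toDual ℝ M).symm (l.comp M.subtypeL)
  have hz : ∀ w : M, l w = ⟪w, z⟫_ℝ := by
    intro w
    rw [real_inner_comm, InnerProductSpace.toDual_symm_apply]
    rfl
  have h1 := hF z
  have h2 : topDualPairing ℝ M F z = ⟪a, z⟫_ℝ := by
    rw [InnerProductSpace.toDual_symm_apply]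
    rfl
  rw [h2, ← hz] at h1
  refine h1.congr fun k => ?_
  exact (hz (y (s k))).symm

/-! ### The space `H¹((a, b); X)` -/

section H1

variable {a b : ℝ} {X : Type*} [NormedAddCommGroup X] [NormedSpace ℝ X] [CompleteSpace X]

theorem IsTest.deriv {φ : ℝ → ℝ} {I : Set ℝ} (hφ : IsTest I φ) : IsTest I (deriv φ) :=
  ⟨by simpa using hφ.1.iterate_deriv 1, hφ.2.1.deriv, tsupport_deriv_subset.trans hφ.2.2⟩

theorem mem_H1_iff {p : WithLp 2 (Lp X 2 (volume.restrict (Set.Ioo a b)) ×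
      Lp X 2 (volume.restrict (Set.Ioo a b)))} :
    p ∈ H1 a b X ↔ ∀ (φ : ℝ → ℝ) (hφ : IsTest (Set.Ioo a b) φ),
      smulIntegral (hφ.deriv.memLp _) p.fst = -smulIntegral (hφ.memLp _) p.snd := by
  simp only [smulIntegral_apply]
  rfl

/-- Each defining identity equates two continuous functions of the pair. The resulting completeness
is what weak compactness needs. -/
theorem isClosed_H1 : IsClosed (H1 a b X : Set (WithLp 2 (Lp X 2 (volume.restrict (Set.Ioo a b)) ×
      Lp X 2 (volume.restrict (Set.Ioo a b))))) := by
  have : (H1 a b X : Set (WithLp 2 (Lp X 2 (volume.restrict (Set.Ioo a b)) ×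
      Lp X 2 (volume.restrict (Set.Ioo a b))))) =
      ⋂ (φ : ℝ → ℝ) (hφ : IsTest (Set.Ioo a b) φ),
        {p | smulIntegral (hφ.deriv.memLp _) p.fst =
          -smulIntegral (hφ.memLp _) p.snd} := by
    ext p
    simp only [SetLike.mem_coe, mem_H1_iff, Set.mem_iInter, Set.mem_ofPred_eq]
  rw [this]
  refine isClosed_iInter fun φ => isClosed_iInter fun hφ => isClosed_eq ?_ ?_
  · exact (smulIntegral _).continuous.comp (WithLp.fstL 2 ℝ _ _).continuous
  · exact ((smulIntegral _).continuous.comp (WithLp.sndL 2 ℝ _ _).continuous).neg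

instance : CompleteSpace (H1 a b X) := isClosed_H1.completeSpace_coe

/-- The inclusion of `H¹((a, b); X)` in `L²((a, b); X)`. -/
def h1ToLp : H1 a b X →L[ℝ] Lp X 2 (volume.restrict (Set.Ioo a b)) :=
  (WithLp.fstL 2 ℝ _ _).comp (H1 a b X).subtypeL

theorem norm_le_add_norm {α β : Type*} [NormedAddCommGroup α] [NormedAddCommGroup β]
    (p : WithLp 2 (α × β)) : ‖p‖ ≤ ‖p.fst‖ + ‖p.snd‖ := by
  rw [WithLp.prod_norm_eq_of_L2]
  refine Real.sqrt_le_iff.2 ⟨by positivity, ?_⟩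
  nlinarith [norm_nonneg p.fst, norm_nonneg p.snd]

theorem exists_weakTendsto_H1 {Y : Type*} [NormedAddCommGroup Y] [InnerProductSpace ℝ Y]
    [CompleteSpace Y] (x : ℕ → H1 a b Y) {R : ℝ} (hx : ∀ n, ‖x n‖ ≤ R) :
    ∃ (s : ℕ → ℕ) (U : H1 a b Y), StrictMono s ∧ WeakTendsto (fun k => x (s k)) U :=
  exists_weakTendsto_of_bounded x hx

end H1

/-- A square integrable function on an open set vanishes if its integrals against all test
functions vanish. -/
theorem Lp_eq_zero_of_smulIntegral_test {E F : Type*} [NormedAddCommGroup E] [NormedSpace ℝ E]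
    [FiniteDimensional ℝ E] [MeasurableSpace E] [BorelSpace E] [NormedAddCommGroup F]
    [NormedSpace ℝ F] [CompleteSpace F] {m : Measure E} [IsFiniteMeasureOnCompacts m] {Ω : Set E}
    (hΩ : IsOpen Ω) (u : Lp F 2 (m.restrict Ω))
    (h : ∀ (η : E → ℝ) (hη : IsTest Ω η), smulIntegral (hη.memLp (m.restrict Ω)) u = 0) : u = 0 := by
  have : ProperSpace E := FiniteDimensional.proper ℝ E
  have hloc : LocallyIntegrableOn u Ω m :=
    fun x hx => by
      obtain ⟨K, hK, hxK, hKΩ⟩ := exists_compact_subset hΩ hx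
      refine ⟨K, mem_nhdsWithin_of_mem_nhds (mem_interior_iff_mem_nhds.1 hxK), ?_⟩
      have : IsFiniteMeasure (m.restrict K) := isFiniteMeasure_restrict.2 hK.measure_lt_top.ne
      exact ((Lp.memLp u).mono_measure (Measure.restrict_mono_set _ hKΩ)).integrable one_le_two
  have := hΩ.ae_eq_zero_of_integral_contDiff_smul_eq_zero hloc fun η h1 h2 h3 => by
    rw [← setIntegral_eq_integral_of_tsupport h3]
    rw [← h η ⟨h1, h2, h3⟩, smulIntegral_apply]
  refine Lp.ext ?_
  filter_upwards [(ae_restrict_iff' hΩ.measurableSet).2 this,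
    Lp.coeFn_zero F 2 (m.restrict Ω)] with x h1 h2
  rw [h1, h2]; rfl

/-! ### The vertical rescaling -/

/-- The vertical dilation `(x̂, y₃) ↦ (x̂, ε y₃)`. -/
def verticalScale {ε : ℝ} (hε : 0 < ε) : E3 ≃L[ℝ] E3 :=
  LinearEquiv.toContinuousLinearEquiv
    { toFun := fun x => join (hat x) (ε * x 2)
      map_add' := fun p q => by ext i; fin_cases i <;> simp [join, mul_add]
      map_smul' := fun c p => by ext i; fin_cases i <;> simp [join, mul_left_comm]
      invFun := fun x => join (hat x) (ε⁻¹ * x 2)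
      left_inv := fun x => by
        ext i; fin_cases i <;> simp [join, hat, hε.ne']
      right_inv := fun x => by
        ext i; fin_cases i <;> simp [join, hat, hε.ne'] }

theorem verticalScale_apply {ε : ℝ} (hε : 0 < ε) (x : E3) :
    verticalScale hε x = join (hat x) (ε * x 2) := rfl

theorem measurableEmbedding_verticalScale {ε : ℝ} (hε : 0 < ε) :
    MeasurableEmbedding (verticalScale hε) :=
  (verticalScale hε).toHomeomorph.measurableEmbedding

theorem det_verticalScale {ε : ℝ} (hε : 0 < ε) :
    LinearMap.det ((verticalScale hε : E3 →L[ℝ] E3) : E3 →ₗ[ℝ] E3) = ε := by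
  rw [← LinearMap.det_toMatrix (EuclideanSpace.basisFun (Fin 3) ℝ).toBasis, Matrix.det_fin_three]
  simp [LinearMap.toMatrix_apply, verticalScale_apply, join, hat]

/-- The dilation has determinant `ε`; the factor `ε⁻¹` is the source of every `ε^(-1/2)` in the
rescaled `L²` norms. -/
theorem map_verticalScale_volume {ε : ℝ} (hε : 0 < ε) :
    Measure.map (verticalScale hε) volume = ENNReal.ofReal ε⁻¹ • (volume : Measure E3) := by
  have h := Measure.map_linearMap_addHaar_eq_smul_addHaar (volume : Measure E3)
    (f := ((verticalScale hε : E3 →L[ℝ] E3) : E3 →ₗ[ℝ] E3))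
    (by rw [det_verticalScale]; exact hε.ne')
  rw [det_verticalScale, abs_of_pos (inv_pos.2 hε)] at h
  exact h

section Rescale

variable {G : E2 → ℝ} {ε : ℝ}

theorem preimage_thinDomain (hε : 0 < ε) :
    verticalScale hε ⁻¹' thinDomain G ε = stretchedDomain G ε := by
  ext x
  simp only [thinDomain, stretchedDomain, Set.mem_preimage, verticalScale_apply,
    Set.mem_ofPred_eq, hat_join, join_two, mul_pos_iff_of_pos_left hε, mul_lt_mul_iff_right₀ hε]

theorem isOpen_thinDomain (hG : Continuous G) : IsOpen (thinDomain G ε) := by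
  have hc : Continuous fun x : E3 => x 2 := by fun_prop
  exact (isOpen_omega.preimage hat.continuous).inter
    ((isOpen_lt continuous_const hc).inter (isOpen_lt hc (by fun_prop)))

theorem measurableSet_stretchedDomain (hG : Continuous G) (hε : 0 < ε) :
    MeasurableSet (stretchedDomain G ε) := by
  rw [← preimage_thinDomain hε]
  exact (isOpen_thinDomain hG).measurableSet.preimage (verticalScale hε).continuous.measurable

theorem stretchedDomain_subset {G₁ : ℝ} (hG : ∀ x, G x ≤ G₁) :
    stretchedDomain G ε ⊆ fixedDomain G₁ :=
  fun _ hx => ⟨hx.1, hx.2.1, hx.2.2.trans_le (hG _)⟩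

theorem map_restrict_stretchedDomain (hG : Continuous G) (hε : 0 < ε) :
    Measure.map (verticalScale hε) (volume.restrict (stretchedDomain G ε)) =
      ENNReal.ofReal ε⁻¹ • volume.restrict (thinDomain G ε) := by
  rw [← preimage_thinDomain hε, ← Measure.restrict_map (verticalScale hε).continuous.measurable
    (isOpen_thinDomain hG).measurableSet, map_verticalScale_volume, Measure.restrict_smul]

/-- The extension by zero of a vertically rescaled function. -/
def rescale {F : Type*} [Zero F] (G : E2 → ℝ) (ε : ℝ) (u : E3 → F) : E3 → F :=
  (stretchedDomain G ε).indicator fun x => u (join (hat x) (ε * x 2))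

theorem rescale_eq {F : Type*} [Zero F] (hε : 0 < ε) (u : E3 → F) :
    rescale G ε u = (stretchedDomain G ε).indicator (u ∘ verticalScale hε) := rfl

variable {F : Type*} [NormedAddCommGroup F] {G₁ : ℝ}

theorem eLpNorm_rescale (hG : Continuous G) (hG₁ : ∀ x, G x ≤ G₁) (hε : 0 < ε) (u : E3 → F) :
    eLpNorm (rescale G ε u) 2 (volume.restrict (fixedDomain G₁)) =
      ENNReal.ofReal ε⁻¹ ^ (1 / 2 : ℝ) * eLpNorm u 2 (volume.restrict (thinDomain G ε)) := by
  rw [rescale_eq hε, eLpNorm_indicator_eq_eLpNorm_restrict (measurableSet_stretchedDomain hG hε),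
    Measure.restrict_restrict (measurableSet_stretchedDomain hG hε),
    Set.inter_eq_left.2 (stretchedDomain_subset hG₁),
    ← (measurableEmbedding_verticalScale hε).eLpNorm_map_measure,
    map_restrict_stretchedDomain hG hε, eLpNorm_smul_measure_of_ne_top (by simp)]
  simp

/-- The factor is exactly that of `rescaledL2Norm`, so the bound on the forces is used with no loss
of powers of `ε`. -/
theorem toReal_eLpNorm_rescale (hG : Continuous G) (hG₁ : ∀ x, G x ≤ G₁) (hε : 0 < ε)
    (u : E3 → F) :
    (eLpNorm (rescale G ε u) 2 (volume.restrict (fixedDomain G₁))).toReal =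
      (√ε)⁻¹ * (eLpNorm u 2 (volume.restrict (thinDomain G ε))).toReal := by
  rw [eLpNorm_rescale hG hG₁ hε, ENNReal.toReal_mul, ENNReal.ofReal_rpow_of_pos (inv_pos.2 hε),
    ENNReal.toReal_ofReal (by positivity), ← Real.sqrt_eq_rpow, Real.sqrt_inv]

theorem memLp_rescale (hG : Continuous G) (hG₁ : ∀ x, G x ≤ G₁) (hε : 0 < ε) {u : E3 → F}
    (hu : MemLp u 2 (volume.restrict (thinDomain G ε))) :
    MemLp (rescale G ε u) 2 (volume.restrict (fixedDomain G₁)) := by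
  rw [rescale_eq hε, memLp_indicator_iff_restrict (measurableSet_stretchedDomain hG hε),
    Measure.restrict_restrict (measurableSet_stretchedDomain hG hε),
    Set.inter_eq_left.2 (stretchedDomain_subset hG₁),
    ← (measurableEmbedding_verticalScale hε).memLp_map_measure_iff,
    map_restrict_stretchedDomain hG hε]
  exact hu.smul_measure ENNReal.ofReal_ne_top

theorem rescale_sub (u v : E3 → F) : rescale G ε (u - v) = rescale G ε u - rescale G ε v :=
  Set.indicator_sub' _ _ _

theorem tendsto_rescale (hG : Continuous G) (hG₁ : ∀ x, G x ≤ G₁) (hε : 0 < ε) {u : ℕ → E3 → F}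
    {v : E3 → F}
    (h : Tendsto (fun k => eLpNorm (u k - v) 2 (volume.restrict (thinDomain G ε))) atTop (𝓝 0)) :
    Tendsto (fun k => eLpNorm (rescale G ε (u k) - rescale G ε v) 2
      (volume.restrict (fixedDomain G₁))) atTop (𝓝 0) := by
  simp_rw [← rescale_sub, eLpNorm_rescale hG hG₁ hε]
  have := ENNReal.Tendsto.const_mul (a := ENNReal.ofReal ε⁻¹ ^ (1 / 2 : ℝ)) h
    (Or.inr (ENNReal.rpow_ne_top_of_nonneg (by norm_num) ENNReal.ofReal_ne_top))
  simpa using this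

/-- The indicator is redundant for functions supported in the thin domain; hence extension by zero
keeps test functions smooth. -/
theorem rescale_eq_comp (hε : 0 < ε) {u : E3 → F} (hu : tsupport u ⊆ thinDomain G ε) :
    rescale G ε u = u ∘ verticalScale hε := by
  rw [rescale_eq hε, Set.indicator_eq_self, ← preimage_thinDomain hε]
  exact fun x hx => hu (subset_tsupport u hx)

theorem IsTest.rescale [NormedSpace ℝ F] (hG₁ : ∀ x, G x ≤ G₁) (hε : 0 < ε) {φ : E3 → F}
    (hφ : IsTest (thinDomain G ε) φ) : IsTest (fixedDomain G₁) (rescale G ε φ) := by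
  rw [rescale_eq_comp hε hφ.2.2]
  refine ⟨hφ.1.comp (verticalScale hε).contDiff,
    hφ.2.1.comp_homeomorph (verticalScale hε).toHomeomorph, ?_⟩
  refine Set.Subset.trans ?_ (stretchedDomain_subset (ε := ε) hG₁)
  rw [← preimage_thinDomain hε]
  exact (tsupport_comp_subset_preimage φ (verticalScale hε).continuous).trans
    (Set.preimage_mono hφ.2.2)

/-- The change of gradients under the vertical dilation. -/
def scaleGrad (ε : ℝ) : Grad 3 E3 →L[ℝ] Grad 3 E3 :=
  ((PiLp.continuousLinearEquiv 2 ℝ fun _ : Fin 3 => E3).symm :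
      (Fin 3 → E3) →L[ℝ] Grad 3 E3).comp <|
    ContinuousLinearMap.pi fun j =>
      (![1, 1, ε] : Fin 3 → ℝ) j • PiLp.proj 2 (fun _ : Fin 3 => E3) j

theorem scaleGrad_apply (ε : ℝ) (D : Grad 3 E3) (j : Fin 3) :
    scaleGrad ε D j = (![1, 1, ε] : Fin 3 → ℝ) j • D j := rfl

theorem classicalGrad_rescale (hε : 0 < ε) {φ : E3 → E3} (hφ : IsTest (thinDomain G ε) φ) :
    classicalGrad (rescale G ε φ) = rescale G ε fun x => scaleGrad ε (classicalGrad φ x) := by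
  have hs : tsupport (fun x => scaleGrad ε (classicalGrad φ x)) ⊆ thinDomain G ε :=
    ((closure_mono (Function.support_comp_subset (map_zero (scaleGrad ε)) (classicalGrad φ))).trans
      (tsupport_classicalGrad_subset φ)).trans hφ.2.2
  rw [rescale_eq_comp hε hφ.2.2, rescale_eq_comp hε hs]
  funext x
  refine PiLp.ext fun j => ?_
  have hd : HasFDerivAt φ (fderiv ℝ φ (verticalScale hε x)) (verticalScale hε x) :=
    ((hφ.1.differentiable (by simp)) _).hasFDerivAt
  have e := (hd.comp x (verticalScale hε).hasFDerivAt).fderiv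
  rw [classicalGrad_apply, e, Function.comp_apply, scaleGrad_apply, classicalGrad_apply,
    ← map_smul, ContinuousLinearMap.comp_apply]
  congr 1
  ext i
  fin_cases j <;> fin_cases i <;> simp [verticalScale_apply, join, hat]

theorem memLp_scaleGrad {α : Type*} [MeasurableSpace α] {m : Measure α} {D : α → Grad 3 E3}
    (hD : MemLp D 2 m) : MemLp (fun x => scaleGrad ε (D x)) 2 m :=
  (scaleGrad ε).comp_memLp' hD

theorem tendsto_scaleGrad {α : Type*} [MeasurableSpace α] {m : Measure α}
    {D : ℕ → α → Grad 3 E3} {D' : α → Grad 3 E3}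
    (h : Tendsto (fun k => eLpNorm (D k - D') 2 m) atTop (𝓝 0)) :
    Tendsto (fun k => eLpNorm ((fun x => scaleGrad ε (D k x)) - fun x => scaleGrad ε (D' x)) 2 m)
      atTop (𝓝 0) := by
  have h2 := ENNReal.Tendsto.const_mul (a := ENNReal.ofReal ‖scaleGrad ε‖) h
    (Or.inr ENNReal.ofReal_ne_top)
  rw [mul_zero] at h2
  refine tendsto_of_tendsto_of_tendsto_of_le_of_le tendsto_const_nhds h2 (fun _ => zero_le)
    fun k => ?_
  refine eLpNorm_le_mul_eLpNorm_of_ae_le_mul (ae_of_all _ fun x => ?_) _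
  simp only [Pi.sub_apply, ← map_sub]
  exact (scaleGrad ε).le_opNorm _

/-- The rescaling maps `H¹₀` of the thin domain to `H¹₀` of the fixed domain. -/
theorem HasH10Grad.rescale (hG : Continuous G) (hG₁ : ∀ x, G x ≤ G₁) (hε : 0 < ε) {u : E3 → E3}
    {Du : E3 → Grad 3 E3} (hu : HasH10Grad (thinDomain G ε) u Du) :
    HasH10Grad (fixedDomain G₁) (rescale G ε u)
      (rescale G ε fun x => scaleGrad ε (Du x)) := by
  obtain ⟨⟨hu, hDu, -⟩, φ, hφ, h, hD⟩ := hu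
  -- The approximating test functions are transported to the cylinder, so derivatives across the
  -- oscillating upper boundary never have to be examined.
  refine hasH10Grad_of_tendsto (isBounded_fixedDomain G₁) (memLp_rescale hG hG₁ hε hu)
    (memLp_rescale hG hG₁ hε (memLp_scaleGrad hDu)) (fun k => (hφ k).rescale hG₁ hε)
    (tendsto_rescale hG hG₁ hε h) ?_
  simp_rw [fun k => classicalGrad_rescale hε (hφ k)]
  exact tendsto_rescale hG hG₁ hε (tendsto_scaleGrad hD)

theorem ae_rescale (hG : Continuous G) (hε : 0 < ε) {p : E3 → Prop}
    (h : ∀ᵐ x ∂(volume.restrict (thinDomain G ε)), p x) :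
    ∀ᵐ x ∂(volume : Measure E3), x ∈ stretchedDomain G ε → p (join (hat x) (ε * x 2)) := by
  rw [← ae_restrict_iff' (measurableSet_stretchedDomain hG hε)]
  have h2 : ∀ᵐ x ∂(Measure.map (verticalScale hε) (volume.restrict (stretchedDomain G ε))), p x := by
    rw [map_restrict_stretchedDomain hG hε]
    exact Measure.ae_smul_measure h _
  exact ae_of_ae_map (verticalScale hε).continuous.aemeasurable h2

/-! ### A priori estimates -/

theorem isAdmissible_zero (Ω : Set E3) : IsAdmissible Ω 0 0 := by
  have ht : IsTest Ω (0 : E3 → E3) := by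
    refine ⟨contDiff_const, HasCompactSupport.zero, ?_⟩
    simp [tsupport]
  have hg : classicalGrad (0 : E3 → E3) = 0 := by
    funext x
    refine PiLp.ext fun j => ?_
    rw [classicalGrad_apply]
    simp
  refine ⟨⟨⟨MemLp.zero, MemLp.zero, fun φ hφ j => by simp⟩, fun _ => 0, fun _ => ht, ?_, ?_⟩, ?_⟩
  · simp
  · simp [hg]
  · simp

/-- The energy estimate, obtained by testing with the zero field. -/
theorem IsBinghamVelocity.energy {μ g : ℝ} (hg : 0 < g) (hε : 0 < ε) {f u : E3 → E3}
    (hf : MemLp f 2 (volume.restrict (thinDomain G ε))) (hu : IsBinghamVelocity μ g G ε f u) :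
    ∃ Du, IsAdmissible (thinDomain G ε) u Du ∧
      μ * ε ^ 2 * (eLpNorm Du 2 (volume.restrict (thinDomain G ε))).toReal ^ 2 ≤
        (eLpNorm f 2 (volume.restrict (thinDomain G ε))).toReal *
          (eLpNorm u 2 (volume.restrict (thinDomain G ε))).toReal := by
  obtain ⟨Du, hDu, h⟩ := hu
  refine ⟨Du, hDu, ?_⟩
  have h0 := h 0 0 (isAdmissible_zero _)
  have h1 := integral_inner_self_of_memLp hDu.1.1.2.1
  have h2 := integral_inner_le_of_memLp hf hDu.1.1.1
  simp only [Pi.zero_apply, zero_sub, inner_neg_right, integral_neg, norm_zero,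
    integral_zero, h1, mul_zero, add_zero] at h0
  -- The yield term has the favourable sign and is discarded.
  have h3 : 0 ≤ g * ε * ∫ x in thinDomain G ε, ‖Du x‖ :=
    mul_nonneg (by positivity) (integral_nonneg fun x => norm_nonneg _)
  linarith

/-- The rescaled velocities are bounded, together with their vertical derivatives, and satisfy a
rescaled incompressibility condition. -/
theorem IsBinghamVelocity.rescaled {μ g : ℝ} (hμ : 0 < μ) (hg : 0 < g) (hε : 0 < ε)
    (hG : Continuous G) (hG₁ : ∀ x, G x ≤ G₁) (hG₁0 : 0 < G₁) {f u : E3 → E3}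
    (hf : MemLp f 2 (volume.restrict (thinDomain G ε))) (hu : IsBinghamVelocity μ g G ε f u)
    {C : ℝ} (hC : rescaledL2Norm G ε f ≤ C) :
    ∃ DU, HasH10Grad (fixedDomain G₁) (rescaledVelocity G ε u) DU ∧
      (∀ᵐ x ∂(volume.restrict (fixedDomain G₁)),
        ε * (DU x 0 0 + DU x 1 1) + DU x 2 2 = 0) ∧
      (eLpNorm (rescaledVelocity G ε u) 2 (volume.restrict (fixedDomain G₁))).toReal ≤
        2 * G₁ * (2 * G₁ * C / μ) ∧
      (eLpNorm (fun x => DU x 2) 2 (volume.restrict (fixedDomain G₁))).toReal ≤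
        2 * G₁ * C / μ := by
  obtain ⟨Du, ⟨hDu, hdiv⟩, hen⟩ := hu.energy hg hε hf
  have hH := hDu.rescale hG hG₁ hε
  have hbd : ∀ x ∈ fixedDomain G₁, |x 2| ≤ G₁ := fun x hx =>
    abs_le.2 ⟨by linarith [hx.2.1], hx.2.2.le⟩
  have hP := hH.poincare (isOpen_fixedDomain G₁).measurableSet 2 hG₁0.le hbd
  -- The thinness of the domain gains a factor `ε` in the Poincaré inequality, compensating one
  -- power of the small viscosity `μ ε²`.
  have hbd' : ∀ x ∈ thinDomain G ε, |x 2| ≤ ε * G₁ := fun x hx =>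
    abs_le.2 ⟨by nlinarith [hx.2.1, mul_pos hε hG₁0],
      hx.2.2.le.trans (mul_le_mul_of_nonneg_left (hG₁ _) hε.le)⟩
  have hP' := hDu.poincare (isOpen_thinDomain hG).measurableSet 2 (by positivity) hbd'
  have hD2 : (eLpNorm (fun x => Du x 2) 2 (volume.restrict (thinDomain G ε))).toReal ≤
      (eLpNorm Du 2 (volume.restrict (thinDomain G ε))).toReal :=
    ENNReal.toReal_mono hDu.1.2.1.2.ne (eLpNorm_mono fun x => norm_grad_apply_le (Du x) 2)
  have hcomp : (eLpNorm (fun x => rescale G ε (fun x => scaleGrad ε (Du x)) x 2) 2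
      (volume.restrict (fixedDomain G₁))).toReal ≤ 2 * G₁ * C / μ := by
    have e : (fun x => rescale G ε (fun x => scaleGrad ε (Du x)) x 2) =
        rescale G ε fun x => ε • Du x 2 := by
      funext x
      by_cases hx : x ∈ stretchedDomain G ε
      · simp only [BinghamThin.rescale, Set.indicator_of_mem hx, scaleGrad_apply]; rfl
      · simp only [BinghamThin.rescale, Set.indicator_of_notMem hx]; rfl
    have e2 : eLpNorm (fun x => ε • Du x 2) 2 (volume.restrict (thinDomain G ε)) =
        ‖ε‖ₑ * eLpNorm (fun x => Du x 2) 2 (volume.restrict (thinDomain G ε)) :=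
      eLpNorm_const_smul ε (fun x => Du x 2) 2 _
    rw [e, toReal_eLpNorm_rescale hG hG₁ hε, e2, ENNReal.toReal_mul, toReal_enorm,
      Real.norm_eq_abs, abs_of_pos hε]
    set A := (eLpNorm Du 2 (volume.restrict (thinDomain G ε))).toReal
    set A2 := (eLpNorm (fun x => Du x 2) 2 (volume.restrict (thinDomain G ε))).toReal
    set B := (eLpNorm f 2 (volume.restrict (thinDomain G ε))).toReal with hB
    set N := (eLpNorm u 2 (volume.restrict (thinDomain G ε))).toReal
    have hA : 0 ≤ A := ENNReal.toReal_nonneg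
    have hB0 : 0 ≤ B := ENNReal.toReal_nonneg
    have hs : 0 < √ε := Real.sqrt_pos.2 hε
    have hss : √ε * √ε = ε := Real.mul_self_sqrt hε.le
    have hCB : (√ε)⁻¹ * B ≤ C := by
      refine le_trans (le_of_eq ?_) hC
      rw [rescaledL2Norm, Real.rpow_neg hε.le, ← Real.sqrt_eq_rpow]
    -- Energy and Poincaré give `μ ε² A² ≤ 2 ε G₁ A B`; one factor `ε A` is cancelled, the case `A =
    -- 0` being trivial.
    have key : μ * (ε * A) ≤ 2 * G₁ * B := by
      rcases hA.eq_or_lt with h0 | h0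
      · rw [← h0]; simp; positivity
      · have : μ * ε ^ 2 * A ^ 2 ≤ B * (2 * (ε * G₁) * A) :=
          hen.trans (mul_le_mul_of_nonneg_left
            (hP'.trans (mul_le_mul_of_nonneg_left hD2 (by positivity))) hB0)
        have h4 : (ε * A) * (μ * (ε * A)) ≤ (ε * A) * (2 * G₁ * B) := by linarith
        exact le_of_mul_le_mul_left h4 (by positivity)
    rw [le_div_iff₀ hμ]
    calc (√ε)⁻¹ * (ε * A2) * μ ≤ (√ε)⁻¹ * (ε * A) * μ := by gcongr
      _ = (√ε)⁻¹ * (μ * (ε * A)) := by ring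
      _ ≤ (√ε)⁻¹ * (2 * G₁ * B) := by gcongr
      _ = 2 * G₁ * ((√ε)⁻¹ * B) := by ring
      _ ≤ 2 * G₁ * C := by gcongr
  refine ⟨_, hH, ?_, hP.trans (mul_le_mul_of_nonneg_left hcomp (by positivity)), hcomp⟩
  -- Inside the stretched domain this is `ε` times the original divergence, the vertical derivative
  -- already containing its `ε`; outside, the extended gradient is zero.
  refine ae_restrict_of_ae ?_
  filter_upwards [ae_rescale hG hε hdiv] with x hx
  by_cases hm : x ∈ stretchedDomain G ε
  · have := hx hm
    rw [Fin.sum_univ_three] at this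
    simp only [BinghamThin.rescale, Set.indicator_of_mem hm, scaleGrad_apply]
    simp
    linear_combination ε * this
  · simp only [BinghamThin.rescale, Set.indicator_of_notMem hm]
    simp

end Rescale

/-! ### Products of functions of the vertical and of the horizontal variables -/

theorem contDiff_vertical_mul_horizontal {φ : ℝ → ℝ} {η : E2 → ℝ} (hφ : ContDiff ℝ ∞ φ)
    (hη : ContDiff ℝ ∞ η) : ContDiff ℝ ∞ fun x : E3 => φ (x 2) * η (hat x) :=
  (hφ.comp (EuclideanSpace.proj (𝕜 := ℝ) (2 : Fin 3)).contDiff).mul (hη.comp hat.contDiff)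

theorem classicalGrad_vertical_mul_horizontal {φ : ℝ → ℝ} {η : E2 → ℝ} (hφ : ContDiff ℝ ∞ φ)
    (hη : ContDiff ℝ ∞ η) (x : E3) :
    classicalGrad (fun x : E3 => φ (x 2) * η (hat x)) x 2 = deriv φ (x 2) * η (hat x) := by
  have h1 : HasFDerivAt (fun x : E3 => φ (x 2)) _ x :=
    ((hφ.differentiable (by simp)) (x 2)).hasDerivAt.hasFDerivAt.comp x
      (EuclideanSpace.proj (𝕜 := ℝ) (2 : Fin 3)).hasFDerivAt
  have h2 : HasFDerivAt (fun x : E3 => η (hat x)) _ x :=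
    ((hη.differentiable (by simp)) (hat x)).hasFDerivAt.comp x hat.hasFDerivAt
  have h3 : hat (EuclideanSpace.single 2 1) = 0 := by
    ext i; fin_cases i <;> simp [hat]
  have h4 : fderiv ℝ (fun x : E3 => φ (x 2) * η (hat x)) x = _ := (h1.mul h2).fderiv
  rw [classicalGrad_apply, h4]
  simp [h3, mul_comm]

theorem exists_contDiff_deriv_eq {φ : ℝ → ℝ} (hφ : ContDiff ℝ ∞ φ) :
    ∃ Z : ℝ → ℝ, ContDiff ℝ ∞ Z ∧ deriv Z = φ := by
  have h : ∀ t, HasDerivAt (fun t => ∫ s in (0 : ℝ)..t, φ s) (φ t) t := fun t =>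
    (hφ.continuous.integral_hasStrictDerivAt 0 t).hasDerivAt
  have hd : deriv (fun t => ∫ s in (0 : ℝ)..t, φ s) = φ := funext fun t => (h t).deriv
  exact ⟨_, contDiff_infty_iff_deriv.2
    ⟨fun t => (h t).differentiableAt, by simpa only [hd] using hφ⟩, hd⟩

/-! ### Curried functions in `H¹((0, h); L²(ω)³)` -/

theorem smulIntegral_compLp {α F F' : Type*} [MeasurableSpace α] [NormedAddCommGroup F]
    [NormedSpace ℝ F] [CompleteSpace F] [NormedAddCommGroup F'] [NormedSpace ℝ F']
    [CompleteSpace F'] {m : Measure α} {a : α → ℝ} (ha : MemLp a 2 m) (L : F →L[ℝ] F')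
    (u : Lp F 2 m) : smulIntegral ha (L.compLpL 2 m u) = L (smulIntegral ha u) := by
  rw [smulIntegral_apply, smulIntegral_apply,
    ← L.integral_comp_comm (integrable_smul_of_memLp ha (Lp.memLp u))]
  refine integral_congr_ae ?_
  filter_upwards [L.coeFn_compLpL u] with x hx
  rw [hx, map_smul]

/-- A continuous linear map annihilates the values of a square integrable function if it
annihilates its integrals against all test functions. -/
theorem ae_map_eq_zero_of_smulIntegral_test {E F F' : Type*} [NormedAddCommGroup E]
    [NormedSpace ℝ E] [FiniteDimensional ℝ E] [MeasurableSpace E] [BorelSpace E]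
    [NormedAddCommGroup F] [NormedSpace ℝ F] [CompleteSpace F] [NormedAddCommGroup F']
    [NormedSpace ℝ F'] [CompleteSpace F'] {m : Measure E} [IsFiniteMeasureOnCompacts m]
    {Ω : Set E} (hΩ : IsOpen Ω) (L : F →L[ℝ] F') (u : Lp F 2 (m.restrict Ω))
    (h : ∀ (η : E → ℝ) (hη : IsTest Ω η), L (smulIntegral (hη.memLp (m.restrict Ω)) u) = 0) :
    ∀ᵐ x ∂(m.restrict Ω), L (u x) = 0 := by
  have hL : L.compLpL 2 (m.restrict Ω) u = 0 :=
    Lp_eq_zero_of_smulIntegral_test hΩ _ fun η hη =>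
      (smulIntegral_compLp (hη.memLp _) L u).trans (h η hη)
  have h1 := L.coeFn_compLpL (p := 2) u
  rw [hL] at h1
  filter_upwards [h1, Lp.coeFn_zero F' 2 (m.restrict Ω)] with x h2 h3
  rw [← h2, h3]
  rfl

section Curry

variable {h : ℝ}

/-- The `L²(ω)`-valued identity is checked by testing it in `x̂` with `η`; Fubini then turns it into
vertical integration by parts of `u` against `φ(x₃) η(x̂)` in the cylinder. -/
theorem mem_H1_of_curry {u : E3 → E3} {Du : E3 → Grad 3 E3}
    (hu : HasH10Grad (fixedDomain h) u Du)
    {A B : Lp L2omega3 2 (volume.restrict (Set.Ioo 0 h))}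
    (hA : ∀ᵐ t ∂(volume.restrict (Set.Ioo 0 h)), ∀ᵐ x ∂(volume.restrict omega),
      A t x = u (join x t))
    (hB : ∀ᵐ t ∂(volume.restrict (Set.Ioo 0 h)), ∀ᵐ x ∂(volume.restrict omega),
      B t x = Du (join x t) 2) :
    WithLp.toLp 2 (A, B) ∈ H1 0 h L2omega3 := by
  refine mem_H1_iff.2 fun φ hφ => eq_neg_iff_add_eq_zero.2 ?_
  refine Lp_eq_zero_of_smulIntegral_test isOpen_omega _ fun η hη => ?_
  have hψ := contDiff_vertical_mul_horizontal hφ.1 hη.1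
  have key := hu.integral_smul (hasH1Grad_of_contDiff (isBounded_fixedDomain h) hψ) 2
  simp only [classicalGrad_vertical_mul_horizontal hφ.1 hη.1] at key
  have e1 := smulIntegral_curry_fixedDomain hu.1.1 hA (hφ.deriv.memLp _) (hη.memLp _)
  have e2 := smulIntegral_curry_fixedDomain (memLp_grad_apply hu.1.2.1 2) hB (hφ.memLp _)
    (hη.memLp _)
  refine (map_add _ _ _).trans ?_
  exact (congrArg₂ (· + ·) (e1.trans key) e2).trans (neg_add_cancel _)

theorem smulIntegral_of_represents {W : H1 0 h L2omega3} {w : E3 → E3} (hW : Represents W w)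
    (hw : MemLp w 2 (volume.restrict (fixedDomain h))) {a : ℝ → ℝ} {b : E2 → ℝ}
    (ha : MemLp a 2 (volume.restrict (Set.Ioo 0 h))) (hb : MemLp b 2 (volume.restrict omega)) :
    smulIntegral hb (smulIntegral ha (h1ToLp W)) =
      ∫ x in fixedDomain h, (a (x 2) * b (hat x)) • w x :=
  smulIntegral_curry_fixedDomain hw hW ha hb

theorem exists_represents {u : E3 → E3} {Du : E3 → Grad 3 E3}
    (hu : HasH10Grad (fixedDomain h) u Du) :
    ∃ W : H1 0 h L2omega3, Represents W u ∧
      ‖W‖ ≤ (eLpNorm u 2 (volume.restrict (fixedDomain h))).toReal +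
        (eLpNorm (fun x => Du x 2) 2 (volume.restrict (fixedDomain h))).toReal := by
  have hD := memLp_grad_apply hu.1.2.1 2
  have hA := exists_curry_fixedDomain hu.1.1
  obtain ⟨A, hA⟩ := hA
  have hB := exists_curry_fixedDomain hD
  obtain ⟨B, hB⟩ := hB
  refine ⟨⟨WithLp.toLp 2 (A, B), mem_H1_of_curry hu hA hB⟩, hA, ?_⟩
  exact (norm_le_add_norm (WithLp.toLp 2 (A, B))).trans
    (add_le_add (norm_curry_fixedDomain hu.1.1 hA).le (norm_curry_fixedDomain hD hB).le)

/-! ### Rescaled incompressibility and vertical integrals -/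

theorem integral_smul_apply {d n : ℕ} {m : Measure (EuclideanSpace ℝ (Fin d))}
    {a : EuclideanSpace ℝ (Fin d) → ℝ} (ha : MemLp a 2 m)
    {u : EuclideanSpace ℝ (Fin d) → EuclideanSpace ℝ (Fin n)} (hu : MemLp u 2 m) (i : Fin n) :
    (∫ x, a x • u x ∂m) i = ∫ x, a x * u x i ∂m :=
  ((EuclideanSpace.proj (𝕜 := ℝ) i).integral_comp_comm (integrable_smul_of_memLp ha hu)).symm

/-- The weak form of the rescaled incompressibility condition. -/
theorem integral_grad_eq_zero_of_rescaled_div {Ω : Set E3} {u : E3 → E3} {Du : E3 → Grad 3 E3}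
    (hu : HasH10Grad Ω u Du) {ε : ℝ}
    (hdiv : ∀ᵐ x ∂(volume.restrict Ω), ε * (Du x 0 0 + Du x 1 1) + Du x 2 2 = 0)
    {ψ : E3 → ℝ} {Dψ : E3 → Grad 3 ℝ} (hψ : HasH1Grad Ω ψ Dψ) :
    ε * ((∫ x in Ω, Dψ x 0 • u x) 0 + (∫ x in Ω, Dψ x 1 • u x) 1) +
      (∫ x in Ω, Dψ x 2 • u x) 2 = 0 := by
  have hI : ∀ j : Fin 3, Integrable (fun x => ψ x * Du x j j) (volume.restrict Ω) := fun j =>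
    (EuclideanSpace.proj (𝕜 := ℝ) j).integrable_comp
      (integrable_smul_of_memLp hψ.1 (memLp_grad_apply hu.1.2.1 j))
  have e : ∀ j : Fin 3, (∫ x in Ω, Dψ x j • u x) j = -∫ x in Ω, ψ x * Du x j j := by
    intro j
    rw [hu.integral_smul hψ j, PiLp.neg_apply,
      integral_smul_apply hψ.1 (memLp_grad_apply hu.1.2.1 j)]
  rw [e, e, e]
  have : ∫ x in Ω, (ε * (ψ x * Du x 0 0 + ψ x * Du x 1 1) + ψ x * Du x 2 2) = 0 := by
    refine integral_eq_zero_of_ae ?_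
    filter_upwards [hdiv] with x hx
    simp only [Pi.zero_apply]
    linear_combination ψ x * hx
  have h01 : Integrable (fun x => ψ x * Du x 0 0 + ψ x * Du x 1 1) (volume.restrict Ω) :=
    (hI 0).add (hI 1)
  rw [integral_add (h01.const_mul ε) (hI 2), integral_const_mul,
    integral_add (hI 0) (hI 1)] at this
  linarith

/-- Exhibits the vertical integral as a bounded linear image of `U`; the constant weight `1` is in
`L²` because the interval is finite. -/
theorem verticalIntegral_eq (U : H1 0 h L2omega3) :
    verticalIntegral U = hat.compLpL 2 (volume.restrict omega)
      (smulIntegral (memLp_const (1 : ℝ)) (h1ToLp U)) := by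
  have h1 := (hat.compLpL 2 (volume.restrict omega)).integral_comp_comm
    ((Lp.memLp (h1ToLp U)).integrable one_le_two)
  have h2 : smulIntegral (memLp_const (1 : ℝ)) (h1ToLp U) = ∫ t in Set.Ioo 0 h, h1ToLp U t := by
    refine (smulIntegral_apply _ _).trans ?_
    simp only [one_smul]
  exact h1.trans (congrArg _ h2.symm)

/-- The right-hand side is a bounded functional of `U`, so it can be evaluated along the weakly
convergent subsequence. -/
theorem integral_inner_verticalIntegral (U : H1 0 h L2omega3) {b : E2 → Grad 2 ℝ}
    (hb : MemLp b 2 (volume.restrict omega)) :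
    ∫ x in omega, ⟪verticalIntegral U x, b x⟫_ℝ =
      (smulIntegral (memLp_grad_apply hb 0) (smulIntegral (memLp_const (1 : ℝ)) (h1ToLp U))) 0 +
      (smulIntegral (memLp_grad_apply hb 1)
        (smulIntegral (memLp_const (1 : ℝ)) (h1ToLp U))) 1 := by
  have hY := verticalIntegral_eq U
  generalize smulIntegral (memLp_const (1 : ℝ)) (h1ToLp U) = Y at hY ⊢
  have hI : ∀ j k, Integrable (fun x => b x j * Y x k) (volume.restrict omega) := fun j k =>
    (EuclideanSpace.proj (𝕜 := ℝ) k).integrable_comp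
      (integrable_smul_of_memLp (memLp_grad_apply hb j) (Lp.memLp Y))
  have e : ∀ j k, (smulIntegral (memLp_grad_apply hb j) Y) k = ∫ x in omega, b x j * Y x k :=
    fun j k => (congrArg (fun z : E3 => z k) (smulIntegral_apply _ Y)).trans
      (integral_smul_apply (memLp_grad_apply hb j) (Lp.memLp Y) k)
  rw [e, e, ← integral_add (hI 0 0) (hI 1 1)]
  refine integral_congr_ae ?_
  have h1 := hat.coeFn_compLpL (p := 2) Y
  rw [← hY] at h1
  filter_upwards [h1] with x hx
  rw [hx, PiLp.inner_apply, Fin.sum_univ_two]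
  rfl

/-- An element of `H¹((0, h); L²(ω)³)` whose vertical component is orthogonal to all products of
test functions has a vanishing vertical component. -/
theorem vertical_component_eq_zero (U : H1 0 h L2omega3)
    (hU : ∀ (φ : ℝ → ℝ) (hφ : IsTest (Set.Ioo 0 h) φ) (η : E2 → ℝ) (hη : IsTest omega η),
      (smulIntegral (hη.memLp (volume.restrict omega))
        (smulIntegral (hφ.memLp _) (h1ToLp U))) 2 = 0) :
    ∀ᵐ t ∂(volume.restrict (Set.Ioo 0 h)), ∀ᵐ x ∂(volume.restrict omega), h1Fun U t x 2 = 0 := by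
  -- Testing is done twice: in `t` for a function with values in `L²(ω)`, then in `x̂` for each
  -- weighted integral.
  have h1 := ae_map_eq_zero_of_smulIntegral_test isOpen_Ioo
    ((EuclideanSpace.proj (𝕜 := ℝ) (2 : Fin 3)).compLpL 2 (volume.restrict omega)) (h1ToLp U)
    fun φ hφ => Lp_eq_zero_of_smulIntegral_test isOpen_omega _ fun η hη =>
      (smulIntegral_compLp _ _ _).trans (hU φ hφ η hη)
  filter_upwards [h1] with t h2
  have h4 := (EuclideanSpace.proj (𝕜 := ℝ) (2 : Fin 3)).coeFn_compLpL (p := 2) (h1ToLp U t)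
  filter_upwards [h4, Lp.coeFn_zero ℝ 2 (volume.restrict omega)] with x h6 h7
  exact h6.symm.trans ((congrArg (fun v : Lp ℝ 2 (volume.restrict omega) => v x) h2).trans h7)

end Curry

/-- The Cauchy–Schwarz inequality for `smulIntegral`. -/
theorem abs_integral_smul_apply_le {d n : ℕ} {m : Measure (EuclideanSpace ℝ (Fin d))}
    {a : EuclideanSpace ℝ (Fin d) → ℝ} (ha : MemLp a 2 m)
    {u : EuclideanSpace ℝ (Fin d) → EuclideanSpace ℝ (Fin n)} (hu : MemLp u 2 m) (i : Fin n) :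
    |(∫ x, a x • u x ∂m) i| ≤ ‖smulIntegral (F := EuclideanSpace ℝ (Fin n)) ha‖ *
      (eLpNorm u 2 m).toReal := by
  rw [← smulIntegral_toLp ha hu, ← Lp.norm_toLp u hu, ← Real.norm_eq_abs]
  exact (PiLp.norm_apply_le _ i).trans
    ((smulIntegral (F := EuclideanSpace ℝ (Fin n)) ha).le_opNorm (hu.toLp u))

/-- The rescaled incompressibility condition controls the vertical velocity. -/
theorem exists_abs_integral_vertical_le (h : ℝ) {φ : ℝ → ℝ} {η : E2 → ℝ} (hφ : ContDiff ℝ ∞ φ)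
    (hη : ContDiff ℝ ∞ η) :
    ∃ K, ∀ (ε : ℝ) (u : E3 → E3) (Du : E3 → Grad 3 E3), 0 < ε → HasH10Grad (fixedDomain h) u Du →
      (∀ᵐ x ∂(volume.restrict (fixedDomain h)),
        ε * (Du x 0 0 + Du x 1 1) + Du x 2 2 = 0) →
      |(∫ x in fixedDomain h, (φ (x 2) * η (hat x)) • u x) 2| ≤
        ε * (K * (eLpNorm u 2 (volume.restrict (fixedDomain h))).toReal) := by
  -- With `Z' = φ`, the test function `Z η` has vertical derivative `φ η`, while its horizontal
  -- derivatives enter with the factor `ε`. `Z` need not have compact support, since `u` is in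
  -- `H¹₀`.
  have hex := exists_contDiff_deriv_eq hφ
  obtain ⟨Z, hZ, hZφ⟩ := hex
  have hψ := hasH1Grad_of_contDiff (isBounded_fixedDomain h)
    (contDiff_vertical_mul_horizontal hZ hη)
  have h0 := memLp_grad_apply hψ.2.1 0
  have h1 := memLp_grad_apply hψ.2.1 1
  refine ⟨‖smulIntegral (F := E3) h0‖ + ‖smulIntegral (F := E3) h1‖,
    fun ε u Du hε hu hdiv => ?_⟩
  have key := integral_grad_eq_zero_of_rescaled_div hu hdiv hψ
  simp only [classicalGrad_vertical_mul_horizontal hZ hη, hZφ] at key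
  have e1 := abs_integral_smul_apply_le h0 hu.1.1 0
  have e2 := abs_integral_smul_apply_le h1 hu.1.1 1
  rw [eq_neg_of_add_eq_zero_right key, abs_neg, abs_mul, abs_of_pos hε, add_mul]
  exact mul_le_mul_of_nonneg_left ((abs_add_le _ _).trans (add_le_add e1 e2)) hε.le

end

end BinghamThin

/-! ### Passage to the limit -/

open BinghamThin

theorem proposition5p1
    (L₁ L₂ G₀ G₁ : ℝ) (hL₁ : 0 < L₁) (hL₂ : 0 < L₂) (hG₀ : 0 < G₀)
    (G : BinghamThin.E2 → ℝ) (hG : ContDiff ℝ ∞ G)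
    (hper₁ : ∀ x, G (x + EuclideanSpace.single 0 L₁) = G x)
    (hper₂ : ∀ x, G (x + EuclideanSpace.single 1 L₂) = G x)
    (hbd : ∀ x, G₀ ≤ G x ∧ G x ≤ G₁)
    (μ g : ℝ) (hμ : 0 < μ) (hg : 0 < g)
    (ε : ℕ → ℝ) (hε : ∀ n, 0 < ε n) (hε0 : Tendsto ε atTop (𝓝 0))
    (f : ℕ → BinghamThin.E3 → BinghamThin.E3)
    (hf : ∀ n, MemLp (f n) 2 (volume.restrict (BinghamThin.thinDomain G (ε n))))
    (C : ℝ) (hfC : ∀ n, BinghamThin.rescaledL2Norm G (ε n) (f n) ≤ C)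
    (u : ℕ → BinghamThin.E3 → BinghamThin.E3)
    (hu : ∀ n, BinghamThin.IsBinghamVelocity μ g G (ε n) (f n) (u n)) :
    (∀ n, BinghamThin.MemH10 (BinghamThin.fixedDomain G₁)
      (BinghamThin.rescaledVelocity G (ε n) (u n))) ∧
    ∃ W : ℕ → BinghamThin.H1 0 G₁ BinghamThin.L2omega3,
      (∀ n, BinghamThin.Represents (W n) (BinghamThin.rescaledVelocity G (ε n) (u n))) ∧
      ∃ (s : ℕ → ℕ) (U : BinghamThin.H1 0 G₁ BinghamThin.L2omega3),
        StrictMono s ∧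
        BinghamThin.WeakTendsto (fun k => W (s k)) U ∧
        (∀ᵐ t ∂(volume.restrict (Set.Ioo 0 G₁)), ∀ᵐ x ∂(volume.restrict BinghamThin.omega),
          BinghamThin.h1Fun U t x 2 = 0) ∧
        BinghamThin.HasWeakDiv BinghamThin.omega (BinghamThin.verticalIntegral U) 0 ∧
        BinghamThin.ZeroNormalTrace BinghamThin.omega (BinghamThin.verticalIntegral U) := by
  have hG₁0 : 0 < G₁ := hG₀.trans_le ((hbd 0).1.trans (hbd 0).2)
  choose DU hH hdiv hbU hbD using fun n => (hu n).rescaled hμ hg (hε n) hG.continuous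
    (fun x => (hbd x).2) hG₁0 (hf n) (hfC n)
  refine ⟨fun n => ⟨_, hH n⟩, ?_⟩
  choose W hW hWn using fun n => exists_represents (hH n)
  have hcpt := exists_weakTendsto_H1 W fun n =>
    (hWn n).trans (add_le_add (hbU n) (hbD n))
  obtain ⟨s, U, hs, hU⟩ := hcpt
  have hlim := weakTendsto_iff.1 hU
  have hεs : Tendsto (fun k => ε (s k)) atTop (𝓝 0) := hε0.comp hs.tendsto_atTop
  have hvert : ∀ᵐ t ∂(volume.restrict (Set.Ioo 0 G₁)), ∀ᵐ x ∂(volume.restrict omega),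
      h1Fun U t x 2 = 0 := by
    refine vertical_component_eq_zero U fun φ hφ η hη => ?_
    have hex := exists_abs_integral_vertical_le G₁ hφ.1 hη.1
    obtain ⟨K, hK⟩ := hex
    refine tendsto_nhds_unique (hlim ((EuclideanSpace.proj (𝕜 := ℝ) (2 : Fin 3)).comp
      ((smulIntegral (hη.memLp (volume.restrict omega))).comp
        ((smulIntegral (hφ.memLp _)).comp h1ToLp)))) ?_
    -- The sign of `K` is not recorded, hence `|K|`; the other factor is the uniform bound on the
    -- rescaled velocities.
    have hεK : Tendsto (fun k => ε (s k) * (|K| * (2 * G₁ * (2 * G₁ * C / μ)))) atTop (𝓝 0) := by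
      simpa using hεs.mul_const (|K| * (2 * G₁ * (2 * G₁ * C / μ)))
    refine squeeze_zero_norm (fun k => ?_) hεK
    have e := congrArg (fun v : E3 => |v 2|) (smulIntegral_of_represents (hW (s k))
      (hH (s k)).1.1 (hφ.memLp _) (hη.memLp (volume.restrict omega)))
    refine e.le.trans ((hK _ _ _ (hε _) (hH (s k)) (hdiv (s k))).trans ?_)
    exact mul_le_mul_of_nonneg_left ((mul_le_mul_of_nonneg_right (le_abs_self K)
      ENNReal.toReal_nonneg).trans (mul_le_mul_of_nonneg_left (hbU _) (abs_nonneg K))) (hε _).le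
  -- Orthogonality to gradients of all of `H¹(ω)`: compactly supported `ψ` give the divergence,
  -- general `ψ` the normal trace.
  have horth : ∀ (ψ : E2 → ℝ) (Dψ : E2 → Grad 2 ℝ), HasH1Grad omega ψ Dψ →
      ∫ x in omega, ⟪verticalIntegral U x, Dψ x⟫_ℝ = 0 := by
    intro ψ Dψ hψ
    refine (integral_inner_verticalIntegral U hψ.2.1).trans ?_
    have hone := memLp_const (μ := volume.restrict (Set.Ioo 0 G₁)) (p := 2) (1 : ℝ)
    refine tendsto_nhds_unique (hlim (((EuclideanSpace.proj (𝕜 := ℝ) (0 : Fin 3)).comp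
      ((smulIntegral (memLp_grad_apply hψ.2.1 0)).comp ((smulIntegral hone).comp h1ToLp))) +
      ((EuclideanSpace.proj (𝕜 := ℝ) (1 : Fin 3)).comp
      ((smulIntegral (memLp_grad_apply hψ.2.1 1)).comp ((smulIntegral hone).comp h1ToLp))))) ?_
    -- The functional vanishes at every `W (s k)`, not only in the limit: `ψ` does not depend on
    -- `y₃`, so the weak constraint is `ε` times this functional.
    refine tendsto_const_nhds.congr fun k => ?_
    simp only [_root_.add_apply, ContinuousLinearMap.comp_apply, PiLp.proj_apply]
    have key := integral_grad_eq_zero_of_rescaled_div (hH (s k)) (hdiv (s k))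
      (hψ.comp_hat (h := G₁))
    have h2 : ∀ D : Grad 2 ℝ, liftGrad D 2 = 0 := fun D => rfl
    simp only [h2, zero_smul, integral_zero, PiLp.zero_apply, add_zero] at key
    have e := fun j => smulIntegral_of_represents (hW (s k)) (hH (s k)).1.1 hone
      (memLp_grad_apply hψ.2.1 j)
    simp only [one_mul] at e
    refine ((mul_eq_zero.1 key).resolve_left (hε _).ne').symm.trans ?_
    exact (congrArg₂ (fun v w : E3 => v 0 + w 1) (e 0) (e 1)).symm
  have hdivU : HasWeakDiv omega (verticalIntegral U) 0 := by
    refine ⟨Lp.memLp _, MemLp.zero, fun φ hφ => ?_⟩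
    rw [horth φ _ (hφ.hasH1Grad isBounded_omega)]
    simp
  refine ⟨W, hW, s, U, hs, hU, hvert, hdivU, 0, hdivU, fun ψ Dψ hψ => ?_⟩
  rw [horth ψ Dψ hψ]
  simp
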